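/- Let $M$ be a matroid of rank $5$ and let $A$ and $B$ be any two bases of $M$. Then $A$ and $B$ have a full serial symmetric exchange of length at most $6$. That is, there are an integer $0\le n\le 6$ and pairs of bases $(A_0,B_0),(A_1,B_1),\dots,(A_n,B_n)$ of $M$ such that $(A_0,B_0)=(A,B)$, $(A_n,B_n)=(B,A)$, and for each $0\le i<n$ there are elements $a\in A_i\setminus B_i$ and $b\in B_i\setminus A_i$ with $$A_{i+1}=(A_i\setminus\{a\})\cup\{b\},\qquad B_{i+1}=(B_i\setminus\{b\})\cup\{a\}.$$ -/

import Mathlib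

namespace Matroid

variable {α : Type*}

/-- The elements `a` and `b` are exchangeable relative to the sets `A` and `B`: `a` lies only in
`A`, `b` lies only in `B`, and both `A - a + b` and `B - b + a` are bases of `M`. -/
def Exchangeable (M : Matroid α) (A B : Set α) (a b : α) : Prop :=
  a ∈ A \ B ∧ b ∈ B \ A ∧ M.IsBase (insert b (A \ {a})) ∧ M.IsBase (insert a (B \ {b}))

/-- `M.SerialSymmExchange n A B A₁ B₁` says that the pair `(A₁, B₁)` is reached from the pair of
bases `(A, B)` by a serial symmetric exchange of length `n`: a sequence of `n` successive
symmetric exchanges, each of a single element against a single element, such that after each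
exchange both of the resulting sets are bases. -/
inductive SerialSymmExchange (M : Matroid α) : ℕ → Set α → Set α → Set α → Set α → Prop
  | refl {A B : Set α} (hA : M.IsBase A) (hB : M.IsBase B) : SerialSymmExchange M 0 A B A B
  | step {n : ℕ} {A B A₁ B₁ : Set α} {a b : α} (h : SerialSymmExchange M n A B A₁ B₁)
      (hab : M.Exchangeable A₁ B₁ a b) :
      SerialSymmExchange M (n + 1) A B (insert b (A₁ \ {a})) (insert a (B₁ \ {b}))

/-- A full serial symmetric exchange of length `n` for `A` and `B`: a serial symmetric exchange
at whose end all elements were exchanged, that is, `A` was turned into `B` and `B` into `A`. -/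
def FullSerialSymmExchange (M : Matroid α) (n : ℕ) (A B : Set α) : Prop :=
  M.SerialSymmExchange n A B B A

end Matroid

open Set

namespace ExchangeSearch

/-- One step of a refutation, acting on the first of a list of states:
* `exch X Y i` applies symmetric exchange to the bases `X`, `Y` and `i ∈ X \ Y`;
* `cut X` distinguishes whether `X` is a base;
* `bad X p` notes that `X` is not good, since otherwise `p` would be a walk of the desired kind. -/
inductive Step
  | exch (X Y i : ℕ)
  | cut (X : ℕ)
  | bad (X : ℕ) (p : List (ℕ × ℕ))

/-- Partial knowledge about the bases among the subsets of `{0, …, 9}`, which are coded by bit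
masks; each field is the set of bits `X` for which it is known that `X` is a base, that `X` is not
a base, and that `X` and its complement are not both bases. -/
structure State where
  pos : ℕ
  neg : ℕ
  bad : ℕ

/-- The complementary bit mask. -/
def co (X : ℕ) : ℕ := 1023 ^^^ X

/-- Exchange of `i` for `j` in the bit mask `X`. -/
def move (X i j : ℕ) : ℕ := X ^^^ (1 <<< i) ^^^ (1 <<< j)

namespace State

/-- Record that `X` is a base. -/
def add (s : State) (X : ℕ) : State := ⟨s.pos ||| (1 <<< X), s.neg, s.bad⟩

/-- It is known that `X` is not a base. -/
def dead (s : State) (X : ℕ) : Bool :=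
  s.neg.testBit X || (s.bad.testBit X && s.pos.testBit (co X))

/-- It is known that `X` and its complement are bases. -/
def good (s : State) (X : ℕ) : Bool := s.pos.testBit X && s.pos.testBit (co X)

/-- Put the state where all elements of a list are bases in front, unless it is contradictory. -/
def addList (s : State) : List ℕ → List State → List State
  | [], gs => s :: gs
  | X :: Xs, gs => bif s.dead X then gs else (s.add X).addList Xs gs

/-- Put the possible outcomes of a symmetric exchange in front, one for each of the last `k`
elements of `{0, …, 9}`. -/
def options (s : State) (X Y i : ℕ) (gs : List State) : ℕ → List State
  | 0 => gs
  | k + 1 => bif Y.testBit (9 - k) && !X.testBit (9 - k) then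
      s.addList [move X i (9 - k), move Y (9 - k) i] (options s X Y i gs k)
      else options s X Y i gs k

/-- The end of a walk from `X` through sets that are known to be good, or equal to `T`. -/
def walk (s : State) (T : ℕ) : ℕ → List (ℕ × ℕ) → Option ℕ
  | X, [] => some X
  | X, (i, j) :: p =>
    bif Nat.ble i 9 && Nat.ble j 9 && X.testBit i && !X.testBit j && 
      (Nat.beq (move X i j) T || s.good (move X i j)) then
      walk s T (move X i j) p
    else none

end State

/-- The walks looked for: at most six exchanges that turn `31` into `992` if the first argument is
`0`, and `k` exchanges, each of one of `0, …, 4` for one of `5, …, 9`, if it is `k > 0`. -/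
def accept : ℕ → List (ℕ × ℕ) → ℕ → Bool
  | 0, p, X => Nat.ble p.length 6 && Nat.beq X 992
  | k + 1, p, _ => Nat.beq p.length (k + 1) && p.all fun q => Nat.ble q.1 4 && Nat.ble 5 q.2

/-- Check a refutation of a list of states. -/
def run (k : ℕ) : List Step → List State → Bool
  | [], [] => true
  | [], _ :: _ => false
  | _ :: _, [] => false
  | .exch X Y i :: l, s :: gs =>
    s.pos.testBit X && s.pos.testBit Y && Nat.ble i 9 && X.testBit i && !Y.testBit i &&
      run k l (s.options X Y i gs 10)
  | .cut X :: l, s :: gs => run k l (s.addList [X] (⟨s.pos, s.neg ||| (1 <<< X), s.bad⟩ :: gs))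
  | .bad X p :: l, s :: gs =>
    (match s.walk X 31 p with | none => false | some Y => accept k p Y) &&
      run k l (bif s.good X then gs else
        ⟨s.pos, s.neg, s.bad ||| (1 <<< X) ||| (1 <<< co X)⟩ :: gs)

/-- The state where the elements of a list are known to be good. -/
def start (l : List ℕ) : State := ⟨l.foldr (fun X m => m ||| (1 <<< X) ||| (1 <<< co X)) 0, 0, 0⟩

/-- The symmetric exchange property, for a family of subsets of `{0, …, 9}` coded by bit masks. -/
def ExchangeFamily (f : ℕ → Prop) : Prop :=
  ∀ ⦃X Y i : ℕ⦄, f X → f Y → i ≤ 9 → X.testBit i = true → Y.testBit i = false →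
    ∃ j ≤ 9, Y.testBit j = true ∧ X.testBit j = false ∧ f (move X i j) ∧ f (move Y j i)

/-- `X` and its complement belong to the family. -/
def Good (f : ℕ → Prop) (X : ℕ) : Prop := f X ∧ f (co X)

/-- `p` lists successive exchanges that lead from `X` to `Y` through good sets. -/
def Walk (f : ℕ → Prop) : ℕ → List (ℕ × ℕ) → ℕ → Prop
  | X, [], Y => X = Y
  | X, (i, j) :: p, Y => i ≤ 9 ∧ j ≤ 9 ∧ X.testBit i = true ∧ X.testBit j = false ∧
      Good f (move X i j) ∧ Walk f (move X i j) p Y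

/-- The knowledge recorded in `s` is true of the family `f`. -/
structure State.Holds (f : ℕ → Prop) (s : State) : Prop where
  pos : ∀ X, s.pos.testBit X = true → f X
  neg : ∀ X, s.neg.testBit X = true → ¬ f X
  bad : ∀ X, s.bad.testBit X = true → ¬ Good f X

variable {f : ℕ → Prop} {s : State} {X Y T i k : ℕ} {gs : List State} {p : List (ℕ × ℕ)}

theorem co_co (X : ℕ) : co (co X) = X := by
  simp [co]

theorem testBit_or_shiftLeft (m X Y : ℕ) :
    (m ||| (1 <<< X)).testBit Y = true ↔ m.testBit Y = true ∨ X = Y := by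
  simp [Nat.testBit_or, Nat.one_shiftLeft, Nat.testBit_two_pow]

theorem State.Holds.add (h : s.Holds f) (hX : f X) : (s.add X).Holds f where
  pos Y hY := by
    rcases (testBit_or_shiftLeft _ _ _).1 hY with hY | rfl
    exacts [h.pos Y hY, hX]
  neg := h.neg
  bad := h.bad

theorem State.Holds.dead_eq_false (h : s.Holds f) (hX : f X) : s.dead X = false := by
  by_contra hd
  simp only [State.dead, Bool.not_eq_false, Bool.or_eq_true, Bool.and_eq_true] at hd
  rcases hd with hd | ⟨hb, hp⟩
  · exact h.neg X hd hX
  · exact h.bad X hb ⟨hX, h.pos _ hp⟩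

theorem State.Holds.exists_mem_addList {Xs : List ℕ} (h : s.Holds f) (hX : ∀ X ∈ Xs, f X) :
    ∃ t ∈ s.addList Xs gs, t.Holds f := by
  induction Xs generalizing s with
  | nil => exact ⟨s, by simp [State.addList], h⟩
  | cons X Xs ih =>
    rw [State.addList, h.dead_eq_false (hX X (by simp)), cond_false]
    exact ih (h.add (hX X (by simp))) fun Y hY => hX Y (by simp [hY])

theorem State.subset_addList (s : State) (Xs : List ℕ) (gs : List State) :
    gs ⊆ s.addList Xs gs := by
  induction Xs generalizing s with
  | nil => simp [State.addList]
  | cons X Xs ih =>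
    rw [State.addList]
    cases s.dead X
    · simpa using ih _
    · simp

theorem State.subset_options (s : State) (X Y i : ℕ) (gs : List State) (k : ℕ) :
    gs ⊆ s.options X Y i gs k := by
  induction k with
  | zero => simp [State.options]
  | succ k ih =>
    rw [State.options]
    cases (Y.testBit (9 - k) && !X.testBit (9 - k))
    · simpa using ih
    · simpa using List.Subset.trans ih (State.subset_addList _ _ _)

theorem State.Holds.exists_mem_options {j : ℕ} (h : s.Holds f) (hj : j ≤ 9) (hk : 9 - j < k)
    (hY : Y.testBit j = true) (hX : X.testBit j = false) (h1 : f (move X i j))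
    (h2 : f (move Y j i)) : ∃ t ∈ s.options X Y i gs k, t.Holds f := by
  induction k with
  | zero => omega
  | succ k ih =>
    rw [State.options]
    rcases (Nat.lt_succ_iff_lt_or_eq.1 hk) with hk | rfl
    · obtain ⟨t, ht, htf⟩ := ih hk
      refine ⟨t, ?_, htf⟩
      cases (Y.testBit (9 - k) && !X.testBit (9 - k))
      · simpa using ht
      · simpa using State.subset_addList _ _ _ ht
    · have : 9 - (9 - j) = j := by omega
      rw [this, hY, hX]
      exact h.exists_mem_addList (by simp [h1, h2])

theorem State.Holds.good (h : s.Holds f) (hX : s.good X = true) : Good f X := by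
  simp only [State.good, Bool.and_eq_true] at hX
  exact ⟨h.pos _ hX.1, h.pos _ hX.2⟩

theorem State.Holds.walk (h : s.Holds f) (hT : Good f T) (hp : s.walk T X p = some Y) :
    Walk f X p Y := by
  induction p generalizing X with
  | nil => simpa [State.walk, Walk] using hp
  | cons q p ih =>
    obtain ⟨i, j⟩ := q
    rw [State.walk, Bool.cond_eq_ite] at hp
    split_ifs at hp with hc
    simp only [Bool.and_eq_true, Bool.or_eq_true, Nat.ble_eq, Nat.beq_eq, Bool.not_eq_true'] at hc
    obtain ⟨⟨⟨⟨hi, hj⟩, hXi⟩, hXj⟩, hg⟩ := hc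
    refine ⟨hi, hj, hXi, hXj, ?_, ih hp⟩
    rcases hg with hg | hg
    · rwa [hg]
    · exact h.good hg

theorem not_holds_of_run {l : List Step} (hf : ExchangeFamily f)
    (hw : ∀ p Y, Walk f 31 p Y → accept k p Y = false) (h : run k l gs = true) :
    ∀ s ∈ gs, ¬ s.Holds f := by
  induction l generalizing gs with
  | nil => cases gs <;> simp_all [run]
  | cons st l ih =>
    cases gs with
    | nil => simp
    | cons s gs =>
      suffices hs : (∀ t ∈ gs, ¬ t.Holds f) ∧ ¬ s.Holds f by simpa [and_comm] using hs
      cases st with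
      | exch X Y i =>
        simp only [run, Bool.and_eq_true, Nat.ble_eq, Bool.not_eq_true'] at h
        obtain ⟨⟨⟨⟨⟨hX, hY⟩, hi⟩, hXi⟩, hYi⟩, hr⟩ := h
        refine ⟨fun t ht => ih hr t (State.subset_options _ _ _ _ _ _ ht), fun hs => ?_⟩
        obtain ⟨j, hj, hYj, hXj, h1, h2⟩ := hf (hs.pos X hX) (hs.pos Y hY) hi hXi hYi
        obtain ⟨t, ht, htf⟩ := hs.exists_mem_options (gs := gs) (k := 10) hj (by omega) hYj hXj h1 h2
        exact ih hr t ht htf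
      | cut X =>
        rw [run] at h
        refine ⟨fun t ht => ih h t (State.subset_addList _ _ _ (by simp [ht])), fun hs => ?_⟩
        by_cases hX : f X
        · obtain ⟨t, ht, htf⟩ := hs.exists_mem_addList (Xs := [X])
            (gs := ⟨s.pos, s.neg ||| (1 <<< X), s.bad⟩ :: gs) (by simpa)
          exact ih h t ht htf
        · refine ih h ⟨s.pos, s.neg ||| (1 <<< X), s.bad⟩
            (State.subset_addList _ _ _ (by simp)) ⟨hs.pos, fun Y hY => ?_, hs.bad⟩
          rcases (testBit_or_shiftLeft _ _ _).1 hY with hY | rfl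
          exacts [hs.neg Y hY, hX]
      | bad X p =>
        rw [run, Bool.and_eq_true] at h
        obtain ⟨h1, h2⟩ := h
        have hbad : s.Holds f → ¬ Good f X := fun hs hX => by
          cases hp : s.walk X 31 p with
          | none => simp [hp] at h1
          | some Y =>
            rw [hp] at h1
            simp [hw p Y (hs.walk hX hp)] at h1
        cases hX : s.good X with
        | true =>
          rw [hX, cond_true] at h2
          exact ⟨ih h2, fun hs => hbad hs (hs.good hX)⟩
        | false =>
          rw [hX, cond_false] at h2
          refine ⟨fun t ht => ih h2 t (by simp [ht]), fun hs => ih h2 _ List.mem_cons_self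
            ⟨hs.pos, hs.neg, fun Y hY => ?_⟩⟩
          rcases (testBit_or_shiftLeft _ _ _).1 hY with hY | rfl
          · rcases (testBit_or_shiftLeft _ _ _).1 hY with hY | rfl
            exacts [hs.bad Y hY, hbad hs]
          · intro hc
            rw [Good, co_co] at hc
            exact hbad hs hc.symm

theorem start_holds {l : List ℕ} (h : ∀ X ∈ l, Good f X) : (start l).Holds f := by
  refine ⟨?_, by simp [start], by simp [start]⟩
  induction l with
  | nil => simp [start]
  | cons X l ih =>
    intro Y hY
    simp only [start, List.foldr_cons] at hY
    rcases (testBit_or_shiftLeft _ _ _).1 hY with hY | rfl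
    · rcases (testBit_or_shiftLeft _ _ _).1 hY with hY | rfl
      · exact ih (fun Z hZ => h Z (by simp [hZ])) Y hY
      · exact (h X (by simp)).1
    · exact (h X (by simp)).2

/-- A successful run of the checker proves the existence of an acceptable walk. -/
theorem exists_walk_of_run {l : List Step} {L : List ℕ} (hf : ExchangeFamily f)
    (hL : ∀ X ∈ L, Good f X) (h : run k l [start L] = true) :
    ∃ p Y, Walk f 31 p Y ∧ accept k p Y = true := by
  by_contra! hw
  exact not_holds_of_run hf (by simpa using hw) h (start L) (by simp) (start_holds hL)

end ExchangeSearch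

namespace Matroid
variable {α β : Type*} {M : Matroid α} {A B X Y : Set α}

/-- Symmetric exchange of basis elements. -/
theorem IsBase.exists_exchangeable {x : α} (hX : M.IsBase X) (hY : M.IsBase Y) (hx : x ∈ X \ Y) :
    ∃ y, M.Exchangeable X Y x y := by
  have hxE : x ∈ M.E := hX.subset_ground hx.1
  have hC := hY.fundCircuit_isCircuit hxE hx.2
  have hK := hX.compl_closure_sdiff_singleton_isCocircuit hx.1
  have hxK : x ∈ M.E \ M.closure (X \ {x}) :=
    ⟨hxE, hX.indep.notMem_closure_sdiff_of_mem hx.1⟩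
  obtain ⟨y, ⟨hyC, hyE, hyK⟩, hyx⟩ := (hC.isCocircuit_inter_nontrivial hK
    ⟨x, M.mem_fundCircuit x Y, hxK⟩).exists_ne x
  have hyY : y ∈ Y := (M.fundCircuit_subset_insert x Y hyC).resolve_left hyx
  have hyX : y ∉ X := fun hy => hyK (M.mem_closure_of_mem' ⟨hy, hyx⟩)
  refine ⟨y, hx, ⟨hyY, hyX⟩, hX.exchange_isBase_of_indep hyX ?_, ?_⟩
  · exact ((hX.indep.subset sdiff_subset).insert_indep_iff_of_notMem (by simp [hyX])).2 ⟨hyE, hyK⟩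
  · rw [insert_sdiff_singleton_comm hyx.symm]
    refine hY.exchange_isBase_of_indep' hyY hx.2 ?_
    rwa [← hY.indep.mem_fundCircuit_iff (by rwa [hY.closure_eq]) hx.2]

end Matroid

namespace ExchangeSearch
open Matroid
variable {β : Type*} {M : Matroid β} {A B : Set β} {e e' : Fin 10 → β} {X X' : ℕ}

theorem testBit_move (X i j k : ℕ) :
    (move X i j).testBit k = ((X.testBit k ^^ decide (i = k)) ^^ decide (j = k)) := by
  simp [move, Nat.testBit_xor, Nat.one_shiftLeft, Nat.testBit_two_pow]

theorem testBit_co {k : ℕ} (X : ℕ) (hk : k ≤ 9) : (co X).testBit k = !X.testBit k := by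
  have : Nat.testBit 1023 k = true := by
    rw [show 1023 = 2 ^ 10 - 1 by norm_num, Nat.testBit_two_pow_sub_one]
    simp; omega
  simp [co, Nat.testBit_xor, this]

theorem co_move (X i j : ℕ) : co (move X i j) = move (co X) j i := by
  simp only [co, move, Nat.xor_assoc, Nat.xor_comm (1 <<< i)]

/-- The set of the elements of `e` selected by a bit mask. -/
def maskSet (e : Fin 10 → β) (X : ℕ) : Set β := e '' {i | X.testBit i = true}

theorem maskSet_move {i j : Fin 10} (he : e.Injective) (hi : X.testBit i = true)
    (hj : X.testBit j = false) :
    maskSet e (move X i j) = insert (e j) (maskSet e X \ {e i}) := by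
  have : {k : Fin 10 | (move X i j).testBit k = true} =
      insert j ({k : Fin 10 | X.testBit k = true} \ {i}) := by
    ext k
    simp only [mem_ofPred_eq, testBit_move, mem_insert_iff, mem_sdiff, mem_singleton_iff]
    by_cases hki : k = i
    · subst hki
      have : j ≠ k := by rintro rfl; simp_all
      simp [hi, Fin.val_inj, this, this.symm]
    · by_cases hkj : k = j
      · subst hkj
        simp [hj, Fin.val_inj, Ne.symm hki]
      · simp [Fin.val_inj, Ne.symm hki, Ne.symm hkj, hki, hkj]
  rw [maskSet, this, image_insert_eq, image_sdiff he, image_singleton, maskSet]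

theorem mem_maskSet {i : Fin 10} (he : e.Injective) :
    e i ∈ maskSet e X ↔ X.testBit i = true := by
  simp [maskSet, he.eq_iff]

theorem maskSet_co_move {i j : Fin 10} (he : e.Injective) (hi : X.testBit i = true)
    (hj : X.testBit j = false) :
    maskSet e (co (move X i j)) = insert (e i) (maskSet e (co X) \ {e j}) := by
  rw [co_move]
  exact maskSet_move he (by rw [testBit_co _ (by omega), hj]; rfl)
    (by rw [testBit_co _ (by omega), hi]; rfl)

/-- The bit masks that select bases. -/
def baseMasks (M : Matroid β) (e : Fin 10 → β) (X : ℕ) : Prop := M.IsBase (maskSet e X)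

theorem exchangeFamily_baseMasks (M : Matroid β) (he : e.Injective) :
    ExchangeFamily (baseMasks M e) := by
  intro X Y i hX hY hi hXi hYi
  lift i to Fin 10 using by omega
  obtain ⟨y, -, ⟨⟨j, hj, rfl⟩, hjX⟩, h1, h2⟩ := hX.exists_exchangeable hY
    ⟨(mem_maskSet (i := i) he).2 hXi, by rw [mem_maskSet he, hYi]; simp⟩
  rw [mem_maskSet he, Bool.not_eq_true] at hjX
  refine ⟨j, by omega, hj, hjX, ?_, ?_⟩
  · rwa [baseMasks, maskSet_move he hXi hjX]
  · rwa [baseMasks, maskSet_move he hj hYi]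

theorem exists_walk {k : ℕ} {l : List Step} {L : List ℕ} (he : e.Injective)
    (hL : ∀ X ∈ L, Good (baseMasks M e) X) (h : run k l [start L] = true) :
    ∃ p Y, Walk (baseMasks M e) 31 p Y ∧ accept k p Y = true :=
  exists_walk_of_run (exchangeFamily_baseMasks M he) hL h

theorem serialSymmExchange_of_walk {n Y : ℕ} {p : List (ℕ × ℕ)} (he : e.Injective)
    (hs : M.SerialSymmExchange n A B (maskSet e X) (maskSet e (co X)))
    (hp : Walk (baseMasks M e) X p Y) :
    M.SerialSymmExchange (n + p.length) A B (maskSet e Y) (maskSet e (co Y)) := by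
  induction p generalizing X n with
  | nil => cases hp; exact hs
  | cons q p ih =>
    obtain ⟨i, j⟩ := q
    obtain ⟨hi, hj, hXi, hXj, ⟨h1, h2⟩, hp⟩ := hp
    lift i to Fin 10 using by omega
    lift j to Fin 10 using by omega
    rw [List.length_cons, add_comm p.length, ← add_assoc]
    refine ih ?_ hp
    rw [baseMasks, maskSet_move he hXi hXj] at h1
    rw [baseMasks, maskSet_co_move he hXi hXj] at h2
    rw [maskSet_move he hXi hXj, maskSet_co_move he hXi hXj]
    refine hs.step ⟨⟨(mem_maskSet he).2 hXi, ?_⟩, ⟨?_, ?_⟩, h1, h2⟩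
    · rw [mem_maskSet he, testBit_co _ (by omega), hXi]; simp
    · rw [mem_maskSet he, testBit_co _ (by omega), hXj]; rfl
    · rw [mem_maskSet he, hXj]; simp

/-- `e` enumerates `A` and then `B`. -/
structure IsLabeling (A B : Set β) (e : Fin 10 → β) : Prop where
  inj : e.Injective
  left : maskSet e 31 = A
  right : maskSet e (co 31) = B

theorem exists_append_of_encard {n : ℕ} (hA : A.encard = n) {l : List β} (hl : l.Nodup)
    (hlA : ∀ x ∈ l, x ∈ A) :
    ∃ l', (l ++ l').Nodup ∧ (l ++ l').length = n ∧ ∀ x, x ∈ l ++ l' ↔ x ∈ A := by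
  classical
  have hfin : A.Finite := finite_of_encard_eq_coe hA
  have hmem : ∀ x, x ∈ l ++ (hfin.toFinset \ l.toFinset).toList ↔ x ∈ A := by
    intro x
    by_cases hx : x ∈ l
    · simp [hx, hlA x hx]
    · simp [hx]
  have hnd : (l ++ (hfin.toFinset \ l.toFinset).toList).Nodup := by
    rw [List.nodup_append']
    exact ⟨hl, Finset.nodup_toList _, fun x hx hx' => by simp_all⟩
  refine ⟨_, hnd, ?_, hmem⟩
  have hAl : A = ((l ++ (hfin.toFinset \ l.toFinset).toList).toFinset : Set β) := by
    ext x
    rw [List.coe_toFinset, mem_ofPred_eq, hmem]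
  rw [hAl, encard_coe_eq_coe_finsetCard, List.toFinset_card_of_nodup hnd] at hA
  exact_mod_cast hA

theorem testBit_31 : ∀ k : Fin 10, Nat.testBit 31 k = decide ((k : ℕ) < 5) := by decide

theorem testBit_co_31 : ∀ k : Fin 10, (co 31).testBit k = decide (5 ≤ (k : ℕ)) := by decide

theorem exists_labeling (hA : A.encard = 5) (hB : B.encard = 5) (hAB : Disjoint A B)
    {l m : List β} (hl : l.Nodup) (hlA : ∀ x ∈ l, x ∈ A) (hm : m.Nodup) (hmB : ∀ x ∈ m, x ∈ B) :
    ∃ e, IsLabeling A B e ∧ (∀ (i : Fin 10) x, l[(i : ℕ)]? = some x → e i = x) ∧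
      ∀ (i : Fin 10) x, 5 ≤ (i : ℕ) → m[(i : ℕ) - 5]? = some x → e i = x := by
  obtain ⟨l', hnl, hll, hl'⟩ := exists_append_of_encard (n := 5) (by exact_mod_cast hA) hl hlA
  obtain ⟨m', hnm, hlm, hm'⟩ := exists_append_of_encard (n := 5) (by exact_mod_cast hB) hm hmB
  set a := l ++ l'
  set b := m ++ m'
  have hlen : (a ++ b).length = 10 := by simp [hll, hlm]
  have hnd : (a ++ b).Nodup := List.nodup_append'.2
    ⟨hnl, hnm, fun x hx hx' => hAB.notMem_of_mem_left ((hl' x).1 hx) ((hm' x).1 hx')⟩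
  have hlt : ∀ i : Fin 10, (i : ℕ) < (a ++ b).length := fun i => by omega
  refine ⟨fun i => (a ++ b)[(i : ℕ)]'(hlt i), ⟨?_, ?_, ?_⟩, ?_, ?_⟩
  · intro i j hij
    exact Fin.ext ((hnd.getElem_inj_iff).1 hij)
  · ext x
    rw [← hl', List.mem_iff_getElem, maskSet]
    constructor
    · rintro ⟨i, hi, rfl⟩
      rw [mem_ofPred_eq, testBit_31, decide_eq_true_eq] at hi
      exact ⟨i, by omega, by simp [List.getElem_append_left (show (i : ℕ) < a.length by omega)]⟩
    · rintro ⟨i, hi, rfl⟩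
      refine ⟨⟨i, by omega⟩, ?_, by simp [List.getElem_append_left hi]⟩
      rw [mem_ofPred_eq, testBit_31, decide_eq_true_eq]
      simp; omega
  · ext x
    rw [← hm', List.mem_iff_getElem, maskSet]
    constructor
    · rintro ⟨i, hi, rfl⟩
      rw [mem_ofPred_eq, testBit_co_31, decide_eq_true_eq] at hi
      exact ⟨i - 5, by omega,
        by simp [List.getElem_append_right (show a.length ≤ (i : ℕ) by omega), hll]⟩
    · rintro ⟨i, hi, rfl⟩
      refine ⟨⟨i + 5, by omega⟩, ?_, ?_⟩
      · rw [mem_ofPred_eq, testBit_co_31, decide_eq_true_eq]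
        simp
      · simp [List.getElem_append_right (show a.length ≤ i + 5 by omega), hll]
  · intro i x hx
    obtain ⟨hi, rfl⟩ := List.getElem?_eq_some_iff.1 hx
    simp [a, List.getElem_append_left, hi]
  · intro i x hi5 hx
    obtain ⟨hi, rfl⟩ := List.getElem?_eq_some_iff.1 hx
    simp [b, List.getElem_append_right (show a.length ≤ (i : ℕ) by omega), hll,
      List.getElem_append_left, hi]

/-- Two labelings select the same pair of complementary sets by the masks `X` and `X'`. -/
def SameMask (e e' : Fin 10 → β) (X X' : ℕ) : Prop :=
  maskSet e X = maskSet e' X' ∧ maskSet e (co X) = maskSet e' (co X')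

theorem SameMask.good (h : SameMask e e' X X') (hX : Good (baseMasks M e) X) :
    Good (baseMasks M e') X' := by
  unfold Good baseMasks at *
  rwa [← h.1, ← h.2]

theorem SameMask.move {i j i' j' : Fin 10} (h : SameMask e e' X X') (he : e.Injective)
    (he' : e'.Injective) (hi : X.testBit i = true) (hj : X.testBit j = false)
    (hii : e' i' = e i) (hjj : e' j' = e j) (hi' : X'.testBit i' = true := by decide)
    (hj' : X'.testBit j' = false := by decide) :
    SameMask e e' (move X i j) (move X' i' j') := by
  refine ⟨?_, ?_⟩
  · rw [maskSet_move he hi hj, maskSet_move he' hi' hj', h.1, hii, hjj]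
  · rw [maskSet_co_move he hi hj, maskSet_co_move he' hi' hj', h.2, hii, hjj]

theorem IsLabeling.sameMask (h : IsLabeling A B e) (h' : IsLabeling A B e') :
    SameMask e e' 31 31 := ⟨h.left.trans h'.left.symm, h.right.trans h'.right.symm⟩

/-- Refutation certificate: after one exchange there are two consecutive exchanges. -/
def chainTwoSteps : List Step :=
  [.bad 110 [(0, 5), (4, 6)], .bad 118 [(0, 5), (3, 6)], .bad 122 [(0, 5), (2, 6)],
    .bad 124 [(0, 5), (1, 6)], .bad 174 [(0, 5), (4, 7)], .bad 182 [(0, 5), (3, 7)],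
    .bad 186 [(0, 5), (2, 7)], .bad 188 [(0, 5), (1, 7)], .bad 302 [(0, 5), (4, 8)],
    .bad 310 [(0, 5), (3, 8)], .bad 314 [(0, 5), (2, 8)], .bad 316 [(0, 5), (1, 8)],
    .bad 558 [(0, 5), (4, 9)], .bad 566 [(0, 5), (3, 9)], .bad 570 [(0, 5), (2, 9)],
    .bad 572 [(0, 5), (1, 9)], .exch 62 961 4, .exch 62 961 3, .exch 62 961 2, .exch 62 961 1,
    .exch 961 62 8, .exch 961 62 9, .bad 103 [(4, 5), (3, 6)], .bad 107 [(4, 5), (2, 6)],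
    .bad 109 [(4, 5), (1, 6)], .bad 115 [(3, 5), (2, 6)], .bad 117 [(3, 5), (1, 6)],
    .bad 121 [(2, 5), (1, 6)], .bad 167 [(4, 5), (3, 7)], .bad 171 [(4, 5), (2, 7)],
    .bad 173 [(4, 5), (1, 7)], .bad 179 [(3, 5), (2, 7)], .bad 181 [(3, 5), (1, 7)],
    .bad 185 [(2, 5), (1, 7)], .bad 295 [(4, 5), (3, 8)], .bad 299 [(4, 5), (2, 8)],
    .bad 301 [(4, 5), (1, 8)], .bad 307 [(3, 5), (2, 8)], .bad 309 [(3, 5), (1, 8)],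
    .bad 313 [(2, 5), (1, 8)], .bad 346 [(0, 8), (2, 6)], .bad 348 [(0, 8), (1, 6)],
    .bad 410 [(0, 8), (2, 7)], .bad 412 [(0, 8), (1, 7)], .bad 551 [(4, 5), (3, 9)],
    .bad 555 [(4, 5), (2, 9)], .bad 557 [(4, 5), (1, 9)], .bad 563 [(3, 5), (2, 9)],
    .bad 565 [(3, 5), (1, 9)], .bad 569 [(2, 5), (1, 9)], .bad 794 [(0, 9), (2, 8)],
    .bad 796 [(0, 9), (1, 8)], .exch 968 55 6, .exch 976 47 6, .exch 964 59 6, .exch 962 61 6,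
    .exch 968 55 7, .exch 976 47 7, .exch 964 59 7, .exch 968 55 8, .exch 976 47 8,
    .exch 964 59 8, .exch 968 55 9, .exch 976 47 9, .exch 964 59 9, .exch 962 61 9,
    .bad 217 [(2, 7), (1, 6)], .bad 345 [(2, 8), (1, 6)], .bad 395 [(4, 8), (2, 7)],
    .bad 405 [(3, 8), (1, 7)], .bad 409 [(2, 8), (1, 7)], .bad 601 [(2, 9), (1, 6)],
    .bad 651 [(4, 9), (2, 7)], .bad 661 [(3, 9), (1, 7)], .bad 665 [(2, 9), (1, 7)],
    .bad 779 [(4, 9), (2, 8)], .bad 789 [(3, 9), (1, 8)], .bad 793 [(2, 9), (1, 8)], .cut 920,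
    .cut 103, .cut 167, .exch 79 167 3, .cut 856, .cut 824, .exch 824 199 5, .exch 283 872 4,
    .exch 376 920 5, .cut 199, .exch 47 199 3, .exch 47 482 3, .exch 47 484 3, .exch 47 737 3,
    .exch 143 551 3, .cut 376, .exch 376 647 5, .cut 472, .exch 79 647 3, .cut 440,
    .exch 440 583 7, .exch 920 233 9, .exch 409 234 0, .exch 410 236 1, .cut 614, .cut 613,
    .cut 611, .exch 481 551 6, .cut 905, .cut 118, .exch 905 944 0, .cut 110, .exch 482 62 6,
    .cut 901, .exch 913 932 0, .exch 47 122 0, .cut 409, .exch 409 936 0, .cut 665,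
    .exch 488 665 8, .cut 913, .exch 488 913 3, .exch 961 155 6, .exch 961 283 6, .exch 961 539 6,
    .cut 678, .cut 806, .cut 422, .exch 31 930 2, .exch 47 902 5]

theorem chainTwoSteps_run :
    run 2 chainTwoSteps [start [31, 62]] = true := by
  decide +kernel

/-- Certificate for three consecutive exchanges, if after the exchanges of `0` for `5` and of `1` for
`6` both `2` and `3` can be exchanged for `0`. -/
def chainThreeStepsFirst : List Step :=
  [.bad 236 [(0, 5), (1, 6), (4, 7)], .bad 244 [(0, 5), (1, 6), (3, 7)],
    .bad 248 [(0, 5), (1, 6), (2, 7)], .bad 364 [(0, 5), (1, 6), (4, 8)],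
    .bad 372 [(0, 5), (1, 6), (3, 8)], .bad 376 [(0, 5), (1, 6), (2, 8)],
    .bad 620 [(0, 5), (1, 6), (4, 9)], .bad 628 [(0, 5), (1, 6), (3, 9)],
    .bad 632 [(0, 5), (1, 6), (2, 9)], .cut 93, .cut 930, .bad 229 [(1, 6), (3, 5), (4, 7)],
    .bad 233 [(1, 6), (2, 5), (4, 7)], .bad 241 [(1, 6), (3, 5), (2, 7)],
    .bad 357 [(1, 6), (3, 5), (4, 8)], .bad 361 [(1, 6), (2, 5), (4, 8)],
    .bad 369 [(1, 6), (3, 5), (2, 8)], .bad 613 [(1, 6), (3, 5), (4, 9)],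
    .bad 617 [(1, 6), (2, 5), (4, 9)], .bad 625 [(1, 6), (3, 5), (2, 9)], .cut 109, .cut 914,
    .cut 976, .cut 964, .cut 968, .cut 604, .cut 601, .cut 589, .cut 597, .cut 713, .cut 310,
    .bad 422 [(0, 5), (3, 8), (4, 7)], .bad 434 [(0, 5), (3, 8), (2, 7)], .cut 434, .cut 422,
    .cut 482, .exch 310 482 2, .cut 358, .exch 358 930 2, .cut 484, .exch 484 310 6,
    .exch 310 992 2, .exch 370 930 4, .cut 406, .exch 62 406 3, .cut 617, .exch 109 713 2,
    .cut 790, .exch 286 902 3, .exch 286 914 2, .cut 241, .cut 229, .exch 117 233 2, .cut 182,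
    .exch 182 902 4, .exch 182 914 2, .exch 422 62 7, .exch 434 62 7,
    .bad 709 [(1, 6), (4, 9), (3, 7)], .bad 721 [(1, 6), (2, 9), (3, 7)], .cut 721, .cut 709,
    .exch 597 713 2, .cut 434, .exch 31 434 2, .exch 62 902 3, .exch 62 914 3, .exch 62 930 3,
    .bad 709 [(1, 6), (3, 9), (4, 7)], .bad 837 [(1, 6), (3, 9), (4, 8)],
    .bad 849 [(1, 6), (3, 9), (2, 8)], .cut 625, .cut 613, .exch 597 426 4, .cut 865,
    .exch 597 865 2, .exch 961 62 7, .bad 440 [(0, 5), (1, 7), (2, 8)], .exch 589 961 2,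
    .exch 589 968 0, .exch 601 709 3, .exch 601 716 0, .cut 426,
    .bad 709 [(1, 6), (3, 9), (4, 7)], .bad 721 [(1, 6), (3, 9), (2, 7)], .cut 314, .cut 302,
    .exch 62 426 2, .exch 906 117 9, .exch 930 458 5, .cut 434, .exch 434 458 4,
    .bad 709 [(1, 6), (4, 9), (3, 7)], .bad 716 [(1, 6), (4, 9), (0, 7)], .cut 613, .cut 314,
    .cut 307, .exch 565 709 4, .cut 59, .exch 59 434 0, .cut 283, .exch 62 283 2, .exch 62 410 2,
    .exch 286 121 2, .exch 346 677 6, .bad 458 [(0, 8), (2, 6), (4, 7)], .cut 186,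
    .exch 186 482 3, .cut 314, .exch 314 482 3, .cut 410, .exch 410 482 3, .exch 482 62 6,
    .exch 914 62 9, .bad 721 [(1, 6), (2, 9), (3, 7)], .bad 728 [(1, 6), (2, 9), (0, 7)],
    .bad 841 [(1, 6), (2, 9), (4, 8)], .cut 617, .cut 302, .cut 295, .cut 182, .cut 233,
    .exch 233 589 5, .cut 737, .exch 589 737 2, .cut 744, .exch 589 744 0, .exch 961 62 8,
    .exch 62 406 3, .exch 121 422 4, .exch 122 310 3, .cut 271, .exch 271 310 0, .cut 47,
    .exch 310 47 4, .exch 310 107 2, .exch 310 107 4, .cut 690, .exch 310 690 2, .exch 316 370 2,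
    .exch 358 307 2, .exch 436 570 7, .cut 327, .exch 327 696 6, .exch 31 355 2, .cut 279,
    .exch 103 279 5, .exch 103 283 6, .exch 899 55 8, .exch 117 589 4, .exch 117 601 2,
    .exch 117 604 0, .exch 906 117 9, .cut 410, .cut 398, .cut 395, .exch 458 31 6,
    .exch 109 601 2, .exch 109 604 0, .exch 914 109 9, .cut 406, .cut 403, .exch 466 31 6,
    .exch 410 899 3, .cut 628, .cut 613, .exch 117 620 0, .exch 121 604 0, .exch 902 121 9,
    .cut 391, .exch 454 899 2, .cut 395, .exch 395 454 0, .cut 628, .cut 625, .exch 117 632 0,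
    .cut 143, .exch 143 451 2, .cut 271, .exch 271 451 2, .exch 451 31 6, .exch 31 454 4,
    .cut 620, .cut 617, .exch 109 632 0, .exch 899 124 9, .cut 458, .cut 466, .cut 391, .cut 632,
    .cut 601, .exch 124 601 2, .exch 968 121 9, .exch 968 124 9, .cut 406, .cut 403,
    .exch 391 466 0, .cut 620, .cut 403, .cut 406, .exch 406 451 2, .exch 451 31 6,
    .exch 466 31 6, .cut 628, .cut 613, .exch 117 620 0, .cut 589, .exch 124 589 4,
    .exch 964 109 9, .exch 964 124 9, .exch 968 109 9, .cut 410, .cut 406, .cut 395, .cut 398,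
    .exch 398 466 2, .exch 458 31 6, .exch 451 914 0, .exch 914 109 9, .exch 124 589 4,
    .exch 451 906 0, .exch 906 117 9, .exch 124 597 3, .exch 906 992 1, .cut 488, .cut 775,
    .cut 248, .exch 121 488 0, .exch 124 233 2, .cut 790, .cut 787, .exch 775 914 0, .cut 787,
    .exch 787 902 0, .cut 236, .cut 233, .exch 109 488 0, .cut 279, .exch 279 899 2, .cut 535,
    .exch 535 899 2, .cut 790, .exch 790 899 2, .exch 899 31 7, .exch 914 31 7, .exch 31 902 3,
    .cut 244, .cut 241, .cut 229, .exch 488 117 7, .cut 457, .exch 457 936 0, .cut 458,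
    .exch 458 936 1, .cut 460, .exch 460 930 2, .cut 472, .exch 472 109 4, .exch 906 117 9,
    .exch 961 426 6, .bad 709 [(1, 6), (3, 9), (4, 7)], .bad 721 [(1, 6), (3, 9), (2, 7)],
    .bad 724 [(1, 6), (3, 9), (0, 7)], .bad 837 [(1, 6), (3, 9), (4, 8)],
    .bad 849 [(1, 6), (3, 9), (2, 8)], .bad 852 [(1, 6), (3, 9), (0, 8)], .cut 709, .cut 314,
    .exch 62 426 2, .cut 837, .cut 721, .exch 597 964 0, .exch 597 976 0, .cut 299, .cut 174,
    .cut 171, .exch 31 426 0, .cut 47, .exch 47 395 2, .cut 59, .exch 59 302 0, .exch 109 426 0,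
    .cut 283, .exch 110 283 5, .cut 307, .exch 110 307 3, .cut 313, .exch 110 313 1,
    .exch 121 302 0, .exch 302 121 2, .exch 362 905 6, .exch 395 110 7, .cut 143, .exch 62 143 4,
    .cut 167, .exch 62 167 3, .cut 173, .exch 62 173 1, .exch 902 121 8, .exch 301 678 8,
    .exch 395 557 8, .exch 422 61 8, .exch 422 109 8, .exch 914 109 7, .exch 205 651 2,
    .exch 818 345 9, .exch 370 653 1, .exch 230 793 1, .exch 234 484 1, .exch 236 182 3,
    .exch 527 496 3, .exch 583 841 1, .bad 440 [(0, 5), (1, 7), (2, 8)], .exch 597 961 2,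
    .exch 597 964 0, .cut 302, .cut 299, .cut 186, .cut 47, .exch 47 426 0, .cut 301,
    .exch 62 301 1, .exch 62 426 2, .exch 914 109 8, .exch 314 690 3, .exch 333 482 3,
    .bad 690 [(0, 5), (2, 9), (3, 7)], .exch 902 961 1, .exch 902 992 1, .cut 710,
    .exch 710 932 1, .cut 779, .cut 244, .exch 117 740 0, .exch 124 229 3, .cut 794, .cut 787,
    .exch 779 914 0, .cut 236, .cut 787, .cut 794, .exch 794 899 3, .exch 899 31 7,
    .exch 914 31 7, .cut 248, .cut 233, .exch 121 236 0, .exch 109 740 0, .cut 794, .cut 403,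
    .exch 906 31 7, .exch 155 899 3, .exch 155 914 0, .cut 628, .cut 613, .exch 117 620 0,
    .cut 709, .exch 709 902 0, .exch 902 121 8, .bad 457 [(1, 6), (2, 8), (4, 7)],
    .bad 465 [(1, 6), (2, 8), (3, 7)], .bad 472 [(1, 6), (2, 8), (0, 7)],
    .bad 841 [(1, 6), (2, 8), (4, 9)], .bad 849 [(1, 6), (2, 8), (3, 9)],
    .bad 856 [(1, 6), (2, 8), (0, 9)], .cut 182, .cut 841, .exch 345 961 3, .cut 566, .cut 174,
    .exch 62 678 3, .cut 465, .exch 345 976 0, .cut 551, .exch 558 117 3, .cut 565,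
    .exch 558 565 1, .exch 614 901 6, .exch 906 117 9, .exch 62 426 2,
    .bad 426 [(0, 5), (2, 7), (4, 8)], .exch 62 678 3, .cut 849, .exch 345 976 0, .cut 558,
    .cut 167, .exch 174 117 3, .cut 181, .exch 174 181 1, .exch 230 901 6, .exch 906 117 7,
    .exch 62 810 2, .bad 810 [(0, 5), (2, 9), (4, 8)], .exch 914 992 1, .cut 752, .cut 775,
    .cut 248, .exch 121 752 0, .exch 124 241 2, .cut 782, .cut 779, .exch 775 906 0, .cut 244,
    .cut 779, .cut 782, .exch 782 899 2, .exch 899 31 7, .exch 906 31 7, .cut 236, .cut 229,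
    .exch 109 244 0, .exch 117 752 0, .cut 782, .cut 395, .exch 902 31 7, .exch 143 899 2,
    .exch 143 906 0, .cut 632, .cut 625, .exch 121 628 0, .cut 721, .exch 721 944 0, .cut 722,
    .exch 722 944 1, .cut 724, .exch 724 930 2, .cut 728, .exch 728 117 3, .exch 914 109 8,
    .bad 453 [(1, 6), (4, 8), (3, 7)], .bad 837 [(1, 6), (4, 8), (3, 9)], .cut 341, .cut 682,
    .bad 465 [(1, 6), (3, 8), (2, 7)], .bad 468 [(1, 6), (3, 8), (0, 7)],
    .bad 849 [(1, 6), (3, 8), (2, 9)], .bad 852 [(1, 6), (3, 8), (0, 9)], .exch 62 961 4,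
    .bad 230 [(0, 5), (4, 6), (3, 7)], .bad 234 [(0, 5), (4, 6), (2, 7)],
    .bad 358 [(0, 5), (4, 6), (3, 8)], .bad 362 [(0, 5), (4, 6), (2, 8)],
    .bad 618 [(0, 5), (4, 6), (2, 9)], .exch 913 110 7, .exch 682 341 9, .exch 597 913 2,
    .exch 913 110 8, .exch 597 689 2, .exch 682 341 7, .exch 213 913 2, .cut 558, .cut 398,
    .cut 174, .exch 110 902 6, .cut 422, .exch 206 422 3, .exch 206 902 3, .exch 302 454 3,
    .exch 333 690 3, .exch 690 906 4, .exch 906 117 8, .exch 327 696 6,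
    .bad 421 [(3, 8), (1, 5), (4, 7)], .bad 805 [(3, 8), (1, 5), (4, 9)], .cut 357,
    .exch 309 714 4, .exch 117 333 4, .exch 333 690 3, .exch 906 117 8, .exch 696 714 4, .cut 403,
    .exch 403 902 0, .exch 403 906 0, .cut 620, .cut 617, .cut 613, .exch 992 109 9, .cut 406,
    .exch 406 899 2, .cut 410, .exch 410 899 3, .cut 659, .exch 659 902 0, .exch 659 906 0,
    .cut 364, .cut 361, .cut 357, .exch 992 109 8, .exch 31 899 4, .cut 662, .exch 662 787 2,
    .cut 666, .exch 666 787 3, .exch 31 902 4, .exch 31 906 4, .cut 236, .cut 233, .cut 229,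
    .exch 992 109 7, .exch 117 906 4, .exch 121 103 3, .exch 124 899 4,
    .bad 230 [(0, 5), (4, 6), (3, 7)], .bad 234 [(0, 5), (4, 6), (2, 7)],
    .bad 358 [(0, 5), (4, 6), (3, 8)], .bad 362 [(0, 5), (4, 6), (2, 8)],
    .bad 614 [(0, 5), (4, 6), (3, 9)], .bad 618 [(0, 5), (4, 6), (2, 9)], .cut 181, .cut 309,
    .cut 433, .cut 689, .cut 817, .cut 405, .cut 618, .cut 654, .cut 369, .exch 117 433 2,
    .exch 117 817 2, .cut 782, .cut 398, .cut 302, .exch 302 654 5, .cut 334, .exch 334 654 6,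
    .exch 913 110 8, .exch 110 906 2, .cut 789, .cut 241, .exch 117 689 2, .cut 398, .cut 143,
    .exch 143 782 0, .cut 158, .exch 158 782 4, .cut 174, .exch 174 405 5, .cut 206,
    .exch 206 309 6, .exch 913 110 7, .exch 181 913 2, .exch 309 661 5, .cut 362, .cut 234,
    .cut 426, .exch 107 426 0, .cut 458, .exch 107 458 0, .exch 906 117 9, .exch 309 689 2,
    .exch 913 110 7, .exch 565 849 2, .exch 625 309 6, .cut 654, .cut 398, .exch 174 902 3,
    .exch 913 110 8, .exch 181 721 2, .bad 422 [(0, 5), (4, 8), (3, 7)], .cut 782,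
    .exch 302 902 3, .exch 902 121 9, .exch 569 721 3, .exch 181 913 2, .exch 309 689 2,
    .exch 913 110 9, .exch 465 689 6, .exch 817 241 8, .cut 782, .cut 654, .exch 558 902 3,
    .exch 906 117 8, .exch 181 341 5, .bad 849 [(1, 6), (3, 8), (2, 9)], .cut 618,
    .exch 110 682 2, .exch 913 110 7, .exch 405 817 2, .exch 906 117 7,
    .bad 465 [(1, 6), (3, 7), (2, 8)], .bad 721 [(1, 6), (3, 7), (2, 9)], .exch 913 110 9,
    .exch 913 110 8, .exch 213 433 2, .exch 405 689 2, .cut 782, .cut 618, .cut 362,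
    .exch 110 906 2, .exch 899 992 0, .exch 902 929 1, .exch 906 929 1, .cut 426, .exch 426 899 3,
    .exch 426 902 3, .exch 426 962 3, .cut 806, .exch 419 806 0, .exch 426 806 3, .exch 482 806 6,
    .cut 682, .exch 419 682 0, .exch 422 682 2, .exch 482 682 6, .cut 434, .exch 434 675 4,
    .exch 434 803 4, .exch 434 899 4, .cut 174, .cut 849, .bad 422 [(0, 5), (4, 7), (3, 8)],
    .bad 678 [(0, 5), (4, 7), (3, 9)], .cut 601, .cut 345, .exch 31 849 3, .exch 93 793 2,
    .cut 865, .cut 721, .cut 302, .bad 422 [(0, 5), (4, 8), (3, 7)],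
    .bad 806 [(0, 5), (4, 8), (3, 9)], .cut 601, .cut 217, .exch 31 721 3, .exch 93 665 2,
    .exch 62 806 3, .cut 341, .exch 341 721 2, .bad 682 [(0, 5), (4, 9), (2, 7)], .cut 465,
    .exch 93 465 2, .bad 810 [(0, 5), (4, 9), (2, 8)], .exch 93 961 4, .exch 117 961 4,
    .exch 121 961 4, .cut 345, .exch 345 721 3, .cut 659, .cut 364, .exch 124 357 3,
    .exch 124 361 2, .cut 651, .cut 647, .exch 426 659 3, .exch 659 174 4,
    .bad 690 [(0, 7), (2, 9), (3, 5)], .exch 899 93 8, .bad 357 [(1, 8), (4, 6), (3, 5)],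
    .bad 361 [(1, 8), (4, 6), (2, 5)], .cut 666, .cut 662, .cut 651, .exch 434 651 4, .cut 654,
    .exch 434 654 4, .exch 682 31 5, .exch 93 961 4, .exch 117 961 4, .exch 121 961 4, .cut 597,
    .exch 465 597 7, .cut 601, .exch 465 601 7, .cut 403, .cut 620, .exch 124 613 3,
    .exch 124 617 2, .cut 395, .cut 391, .exch 403 174 4, .exch 403 426 0,
    .bad 434 [(0, 7), (2, 8), (3, 5)], .exch 899 93 9, .bad 613 [(1, 9), (4, 6), (3, 5)],
    .bad 617 [(1, 9), (4, 6), (2, 5)], .cut 410, .cut 406, .cut 395, .exch 395 434 0, .cut 398,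
    .exch 398 434 2, .exch 426 31 5, .exch 803 961 1, .exch 835 117 1, .exch 835 121 1, .cut 182,
    .bad 422 [(0, 5), (3, 7), (4, 8)], .bad 678 [(0, 5), (3, 7), (4, 9)], .cut 601, .cut 345,
    .exch 31 841 4, .exch 93 793 2, .exch 62 434 2, .bad 426 [(0, 5), (2, 7), (4, 8)],
    .bad 682 [(0, 5), (2, 7), (4, 9)], .cut 597, .cut 341, .exch 31 837 4, .exch 93 789 3,
    .exch 62 422 3, .exch 62 678 3, .cut 465, .bad 678 [(0, 5), (4, 9), (3, 7)],
    .bad 806 [(0, 5), (4, 9), (3, 8)], .cut 345, .cut 217, .exch 31 465 3, .exch 93 409 2,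
    .cut 213, .exch 213 961 2, .bad 810 [(0, 5), (4, 8), (2, 9)], .cut 721, .exch 93 721 2,
    .bad 426 [(0, 5), (4, 8), (2, 7)], .exch 93 961 4, .exch 117 961 4, .exch 121 961 4, .cut 217,
    .exch 217 849 3, .cut 236, .cut 787, .exch 899 93 7, .bad 229 [(1, 7), (4, 6), (3, 5)],
    .bad 233 [(1, 7), (4, 6), (2, 5)], .cut 794, .cut 790, .cut 779, .exch 434 779 4, .cut 782,
    .exch 434 782 4, .exch 810 31 5, .exch 124 229 3, .exch 124 233 2, .exch 124 961 4, .cut 779,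
    .cut 775, .exch 803 31 5, .exch 422 787 2, .bad 233 [(4, 5), (1, 6), (2, 7)], .cut 914,
    .exch 419 914 0, .exch 124 899 4, .bad 230 [(0, 5), (4, 6), (3, 7)],
    .bad 234 [(0, 5), (4, 6), (2, 7)], .bad 358 [(0, 5), (4, 6), (3, 8)],
    .bad 362 [(0, 5), (4, 6), (2, 8)], .bad 614 [(0, 5), (4, 6), (3, 9)],
    .bad 618 [(0, 5), (4, 6), (2, 9)], .cut 206, .cut 590, .cut 433, .exch 433 482 0, .cut 689,
    .exch 482 689 6, .cut 369, .cut 625, .cut 61, .bad 369 [(1, 5), (3, 6), (2, 8)],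
    .bad 625 [(1, 5), (3, 6), (2, 9)], .cut 654, .cut 398, .exch 31 902 3, .exch 206 782 6,
    .cut 405, .cut 618, .exch 110 682 2, .exch 110 810 2, .exch 362 590 5, .cut 789, .cut 661,
    .cut 565, .exch 405 565 7, .cut 569, .exch 569 405 9, .exch 31 689 2, .exch 181 539 5,
    .bad 433 [(1, 7), (3, 5), (2, 8)], .exch 433 31 5, .cut 614, .exch 110 678 3, .exch 110 806 3,
    .exch 358 590 5, .cut 793, .cut 665, .cut 569, .exch 409 569 7, .cut 565, .exch 565 409 9,
    .exch 31 689 3, .exch 185 535 5, .bad 433 [(1, 7), (2, 5), (3, 8)], .exch 117 752 0,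
    .exch 121 628 0, .cut 395, .cut 391, .exch 419 206 5, .exch 899 31 9, .exch 899 174 9,
    .bad 906 [(4, 9), (0, 7), (2, 8)], .exch 117 496 0, .exch 121 372 0, .cut 651, .cut 647,
    .exch 675 590 5, .exch 899 31 8, .exch 899 558 8, .bad 906 [(4, 8), (0, 9), (2, 7)],
    .exch 675 913 1, .exch 913 110 8, .bad 422 [(0, 5), (4, 8), (3, 7)],
    .bad 806 [(0, 5), (4, 8), (3, 9)], .cut 601, .cut 217, .exch 31 721 3, .cut 91,
    .exch 91 665 1, .exch 93 659 2, .exch 419 913 1, .exch 913 110 9,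
    .bad 678 [(0, 5), (4, 9), (3, 7)], .bad 806 [(0, 5), (4, 9), (3, 8)], .cut 345, .cut 217,
    .exch 31 465 3, .cut 91, .exch 91 409 1, .exch 93 403 2, .exch 913 110 9,
    .bad 678 [(0, 5), (4, 9), (3, 7)], .bad 806 [(0, 5), (4, 9), (3, 8)], .cut 345, .cut 217,
    .exch 31 465 3, .exch 93 409 2, .exch 913 110 7, .bad 422 [(0, 5), (4, 7), (3, 8)],
    .bad 678 [(0, 5), (4, 7), (3, 9)], .cut 601, .cut 345, .exch 31 849 3, .exch 93 793 2,
    .cut 675, .exch 426 675 3, .cut 678, .exch 426 678 3, .cut 738, .exch 426 738 3,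
    .exch 899 124 8, .exch 929 707 5, .exch 707 422 9, .exch 707 806 7,
    .bad 428 [(0, 5), (1, 8), (4, 7)], .bad 436 [(0, 5), (1, 8), (3, 7)],
    .bad 440 [(0, 5), (1, 8), (2, 7)], .bad 812 [(0, 5), (1, 8), (4, 9)],
    .bad 820 [(0, 5), (1, 8), (3, 9)], .bad 824 [(0, 5), (1, 8), (2, 9)], .cut 309, .cut 313,
    .cut 301, .cut 710, .exch 227 710 0, .exch 611 710 0, .exch 710 737 1, .cut 714, .cut 722,
    .exch 227 722 0, .cut 118, .cut 905, .bad 230 [(0, 5), (3, 6), (4, 7)],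
    .bad 614 [(0, 5), (3, 6), (4, 9)], .cut 793, .cut 409, .exch 313 710 5, .exch 31 905 4,
    .exch 283 665 1, .exch 426 961 3, .cut 244, .cut 779, .exch 301 906 0, .exch 313 906 0,
    .exch 395 611 7, .cut 628, .cut 211, .cut 199, .exch 707 124 9, .exch 740 604 5,
    .exch 227 31 5, .exch 203 118 3, .exch 203 244 3, .bad 724 [(0, 6), (1, 7), (3, 9)],
    .exch 117 230 0, .exch 117 242 0, .exch 124 229 3, .exch 124 241 2, .cut 787, .cut 775,
    .exch 803 31 5, .exch 422 779 2, .bad 241 [(3, 5), (1, 6), (2, 7)], .exch 62 230 3,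
    .exch 62 614 3, .exch 117 182 0, .exch 117 566 0, .cut 779, .cut 395, .exch 31 899 3,
    .cut 299, .exch 299 651 5, .exch 301 651 8, .cut 372, .cut 358, .exch 117 358 0, .cut 370,
    .exch 117 370 0, .cut 310, .exch 714 310 6, .exch 230 309 7, .exch 309 806 0, .exch 47 482 2,
    .cut 587, .cut 203, .exch 107 651 5, .exch 316 707 4, .bad 422 [(0, 5), (4, 8), (3, 7)],
    .bad 806 [(0, 5), (4, 8), (3, 9)], .cut 601, .cut 217, .exch 31 721 3, .exch 93 665 2,
    .exch 316 707 3, .bad 422 [(0, 5), (3, 8), (4, 7)], .bad 806 [(0, 5), (3, 8), (4, 9)],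
    .cut 601, .cut 217, .exch 31 713 4, .exch 93 665 2, .exch 316 707 2,
    .bad 426 [(0, 5), (2, 8), (4, 7)], .bad 810 [(0, 5), (2, 8), (4, 9)], .cut 597, .cut 213,
    .exch 31 709 4, .exch 93 661 3, .exch 316 707 4, .bad 422 [(0, 5), (4, 8), (3, 7)],
    .bad 806 [(0, 5), (4, 8), (3, 9)], .cut 601, .cut 217, .exch 31 721 3, .exch 93 665 2,
    .exch 316 707 2, .bad 426 [(0, 5), (2, 8), (4, 7)], .bad 810 [(0, 5), (2, 8), (4, 9)],
    .cut 597, .cut 213, .exch 117 709 4, .exch 316 707 3, .bad 422 [(0, 5), (3, 8), (4, 7)],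
    .bad 806 [(0, 5), (3, 8), (4, 9)], .cut 601, .cut 217, .exch 121 713 4, .cut 803,
    .exch 422 803 2, .cut 810, .exch 422 810 2, .cut 818, .exch 422 818 2, .cut 866,
    .exch 422 866 2, .exch 899 124 7, .exch 929 835 5, .exch 835 426 9,
    .bad 428 [(0, 5), (1, 7), (4, 8)], .bad 436 [(0, 5), (1, 7), (3, 8)],
    .bad 440 [(0, 5), (1, 7), (2, 8)], .bad 684 [(0, 5), (1, 7), (4, 9)],
    .bad 692 [(0, 5), (1, 7), (3, 9)], .bad 696 [(0, 5), (1, 7), (2, 9)], .cut 181, .cut 185,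
    .cut 173, .cut 850, .exch 355 850 0, .exch 850 865 1, .cut 109, .cut 838, .exch 355 838 0,
    .cut 842, .exch 355 842 0, .cut 914, .exch 355 914 5, .cut 678, .exch 355 678 8,
    .exch 358 678 6, .exch 362 678 8, .cut 118, .cut 182, .cut 841,
    .bad 422 [(0, 5), (3, 7), (4, 8)], .bad 678 [(0, 5), (3, 7), (4, 9)], .cut 601, .cut 345,
    .exch 31 841 4, .exch 93 793 2, .cut 587, .cut 436, .exch 181 422 0, .exch 181 434 0,
    .exch 188 421 3, .exch 188 433 2, .cut 595, .cut 583, .exch 370 587 4, .exch 587 118 3,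
    .bad 850 [(0, 6), (2, 9), (3, 8)], .exch 109 842 0, .exch 121 842 0, .exch 331 611 3,
    .cut 692, .cut 403, .cut 391, .exch 181 932 0, .exch 899 188 9, .exch 932 668 5,
    .exch 419 31 5, .exch 395 182 3, .exch 395 436 3, .bad 916 [(0, 7), (1, 8), (3, 9)],
    .exch 62 422 3, .exch 62 678 3, .exch 118 181 1, .exch 181 310 0, .exch 181 566 0, .cut 779,
    .cut 587, .cut 331, .exch 31 835 3, .exch 62 358 3, .exch 62 614 3, .exch 117 310 0,
    .exch 117 566 0, .cut 651, .cut 395, .exch 31 906 0, .cut 143, .exch 143 779 2, .cut 155,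
    .exch 155 779 4, .cut 171, .exch 171 779 5, .exch 173 779 7, .cut 203, .exch 203 566 6,
    .cut 244, .cut 230, .exch 117 230 0, .cut 242, .exch 117 242 0, .cut 182, .exch 842 182 6,
    .exch 181 422 0, .cut 214, .exch 618 214 5, .exch 158 614 3, .exch 181 678 0, .exch 47 482 2,
    .cut 587, .cut 331, .cut 79, .exch 79 779 2, .cut 91, .exch 91 779 4, .exch 107 662 5,
    .cut 611, .exch 422 611 8, .exch 835 188 8, .cut 583, .cut 440, .exch 185 426 0,
    .exch 185 434 0, .exch 188 425 2, .exch 188 433 2, .cut 595, .cut 587, .exch 583 121 2,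
    .exch 707 109 7, .exch 707 117 7, .cut 436, .cut 428, .exch 181 422 0, .exch 188 421 3,
    .exch 124 899 4, .exch 370 906 4, .exch 794 913 1, .exch 899 880 0, .exch 906 817 3,
    .bad 358 [(0, 5), (4, 6), (3, 8)], .bad 362 [(0, 5), (4, 6), (2, 8)],
    .bad 614 [(0, 5), (4, 6), (3, 9)], .cut 665, .cut 661, .exch 185 838 5, .exch 155 913 1,
    .exch 155 920 0, .cut 157, .exch 157 659 2, .exch 185 659 3, .cut 668, .exch 185 668 0,
    .exch 689 31 5, .exch 835 188 9, .bad 229 [(1, 5), (4, 7), (3, 6)],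
    .bad 357 [(1, 5), (3, 6), (4, 8)], .bad 824 [(0, 5), (1, 9), (2, 8)], .cut 357, .cut 229,
    .cut 199, .cut 167, .exch 93 167 6, .cut 103, .exch 103 173 1, .exch 109 419 3,
    .exch 188 835 3, .exch 426 838 3, .exch 426 850 3, .exch 794 841 1,
    .bad 422 [(0, 5), (3, 7), (4, 8)], .bad 434 [(0, 5), (3, 7), (2, 8)],
    .bad 678 [(0, 5), (3, 7), (4, 9)], .cut 601, .cut 244, .exch 121 902 5, .exch 91 841 1,
    .exch 91 856 0, .exch 93 587 2, .exch 121 587 4, .exch 121 602 0,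
    .bad 241 [(2, 6), (1, 5), (3, 7)], .bad 617 [(2, 6), (1, 5), (4, 9)], .cut 678, .cut 436,
    .cut 434, .cut 406, .cut 391, .cut 241, .cut 279, .exch 279 902 0, .exch 422 794 2, .cut 433,
    .exch 433 790 0, .cut 566, .exch 566 902 4, .exch 790 181 8, .exch 850 181 6, .exch 914 309 7,
    .exch 188 835 2, .exch 422 850 2, .exch 790 837 1, .bad 426 [(0, 5), (2, 7), (4, 8)],
    .bad 434 [(0, 5), (2, 7), (3, 8)], .bad 682 [(0, 5), (2, 7), (4, 9)], .cut 597, .cut 248,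
    .exch 117 906 5, .exch 87 837 1, .exch 87 852 0, .exch 93 583 3, .exch 117 583 4,
    .exch 117 598 0, .exch 121 186 0, .bad 613 [(3, 6), (1, 5), (4, 9)], .cut 682, .cut 434,
    .cut 410, .cut 395, .cut 283, .exch 283 906 0, .exch 426 790 3, .cut 570, .exch 570 906 4,
    .exch 613 794 5, .exch 794 31 8, .exch 794 122 8, .cut 403, .exch 794 403 3, .exch 824 602 5,
    .exch 899 286 9, .exch 117 173 4, .exch 121 173 4, .exch 124 173 4,
    .bad 229 [(1, 5), (4, 7), (3, 6)], .bad 233 [(1, 5), (4, 7), (2, 6)], .cut 794, .cut 790,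
    .cut 787, .exch 850 173 6, .exch 188 835 4, .bad 422 [(0, 5), (4, 7), (3, 8)],
    .bad 426 [(0, 5), (4, 7), (2, 8)], .cut 601, .cut 597, .cut 541, .exch 541 849 2, .cut 793,
    .exch 793 93 8, .cut 539, .exch 849 539 6, .exch 31 849 2, .exch 93 789 3, .exch 188 835 4,
    .bad 422 [(0, 5), (4, 7), (3, 8)], .bad 426 [(0, 5), (4, 7), (2, 8)], .cut 601, .cut 597,
    .cut 541, .exch 541 849 2, .cut 793, .exch 793 93 8, .cut 539, .exch 849 539 6,
    .exch 31 849 2, .exch 93 789 3, .exch 121 181 3, .exch 121 188 0,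
    .bad 233 [(1, 5), (2, 6), (4, 7)], .bad 241 [(1, 5), (3, 6), (2, 7)], .cut 782, .cut 775,
    .exch 902 121 7, .exch 117 188 0, .bad 229 [(1, 5), (3, 6), (4, 7)],
    .bad 241 [(1, 5), (3, 6), (2, 7)], .cut 779, .exch 906 117 7, .cut 419, .exch 419 906 0,
    .cut 422, .exch 422 906 2, .cut 434, .exch 434 906 4, .cut 482, .exch 482 31 6,
    .exch 899 124 9, .exch 929 451 5, .bad 684 [(0, 5), (1, 9), (4, 7)],
    .bad 692 [(0, 5), (1, 9), (3, 7)], .bad 696 [(0, 5), (1, 9), (2, 7)],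
    .bad 812 [(0, 5), (1, 9), (4, 8)], .bad 820 [(0, 5), (1, 9), (3, 8)],
    .bad 824 [(0, 5), (1, 9), (2, 8)], .cut 565, .cut 454, .cut 458, .exch 458 481 1, .cut 109,
    .cut 914, .cut 569, .cut 557, .cut 466, .cut 355, .exch 355 454 0, .exch 355 466 0,
    .exch 355 902 5, .exch 355 914 5, .exch 355 962 0, .cut 234, .exch 234 358 3, .exch 234 370 3,
    .exch 234 806 7, .exch 234 818 7, .exch 234 866 3, .cut 118, .cut 566, .cut 457,
    .bad 678 [(0, 5), (3, 9), (4, 7)], .bad 806 [(0, 5), (3, 9), (4, 8)], .cut 345, .cut 217,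
    .exch 31 457 4, .exch 93 409 2, .cut 331, .cut 692, .exch 565 678 0, .exch 565 690 0,
    .exch 572 677 3, .exch 572 689 2, .cut 339, .cut 327, .exch 242 331 4, .exch 331 118 3,
    .bad 466 [(0, 6), (2, 8), (3, 7)], .exch 109 458 0, .exch 121 458 0, .exch 203 355 3,
    .cut 820, .cut 659, .cut 647, .exch 565 932 0, .exch 899 572 8, .exch 932 796 5,
    .exch 675 31 5, .exch 651 566 3, .exch 651 692 3, .bad 916 [(0, 9), (1, 7), (3, 8)],
    .exch 62 678 3, .exch 62 806 3, .exch 118 565 1, .exch 182 565 1, .exch 310 565 1, .cut 395,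
    .cut 331, .cut 203, .exch 31 451 3, .exch 62 230 3, .exch 62 358 3, .exch 117 182 0,
    .exch 117 310 0, .cut 779, .cut 651, .exch 31 899 3, .cut 555, .exch 395 555 7,
    .exch 557 395 9, .cut 628, .cut 614, .exch 117 614 0, .exch 230 565 7, .exch 358 565 8,
    .exch 47 738 2, .cut 331, .cut 203, .exch 107 395 5, .exch 62 488 1, .cut 171,
    .exch 171 362 0, .cut 182, .exch 182 362 7, .cut 227, .exch 188 227 3, .exch 451 572 8,
    .bad 428 [(0, 5), (1, 8), (4, 7)], .cut 199, .cut 824, .exch 316 818 2, .exch 316 936 2,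
    .exch 440 569 7, .cut 327, .cut 211, .cut 203, .cut 91, .exch 454 91 7, .cut 107,
    .exch 454 107 7, .cut 115, .exch 454 115 7, .cut 87, .exch 87 936 2, .exch 121 199 4,
    .exch 451 109 8, .exch 451 117 8, .cut 820, .cut 812, .exch 316 806 3, .exch 62 451 5,
    .cut 806, .exch 227 806 7, .cut 810, .exch 227 810 7, .cut 818, .exch 227 818 7,
    .exch 451 572 7, .exch 62 902 5, .exch 62 906 5, .exch 62 914 5, .cut 327, .cut 696,
    .exch 188 682 2, .exch 188 690 2, .cut 339, .cut 331, .exch 327 121 2, .exch 451 109 7,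
    .exch 451 117 7, .cut 692, .cut 684, .exch 188 678 3, .exch 451 914 0, .exch 454 403 2,
    .exch 458 403 3, .exch 572 451 4, .bad 678 [(0, 5), (4, 9), (3, 7)],
    .bad 682 [(0, 5), (4, 9), (2, 7)], .bad 806 [(0, 5), (4, 9), (3, 8)],
    .bad 810 [(0, 5), (4, 9), (2, 8)], .cut 620, .exch 121 902 5, .exch 117 906 5,
    .bad 613 [(3, 6), (1, 5), (4, 9)], .bad 617 [(2, 6), (1, 5), (4, 9)], .cut 617, .cut 613,
    .cut 737, .exch 109 737 2, .cut 740, .exch 109 740 0, .cut 229, .exch 229 992 0, .cut 744,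
    .exch 744 117 7, .exch 109 992 2, .cut 865, .exch 233 865 3, .exch 233 868 0, .exch 109 565 3,
    .exch 109 569 2, .exch 109 572 0, .bad 613 [(1, 5), (3, 9), (4, 6)],
    .bad 617 [(1, 5), (2, 9), (4, 6)], .cut 410, .cut 406, .cut 403, .cut 283, .exch 283 914 0,
    .cut 286, .exch 286 914 2, .cut 794, .exch 794 31 8, .cut 279, .exch 906 279 7, .cut 790,
    .exch 31 790 0, .exch 31 914 2, .exch 121 565 3, .exch 121 572 0, .exch 572 451 2,
    .bad 229 [(1, 5), (4, 6), (3, 7)], .bad 233 [(1, 5), (4, 6), (2, 7)],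
    .bad 625 [(1, 5), (3, 9), (2, 6)], .bad 818 [(0, 5), (2, 9), (3, 8)], .cut 398, .cut 391,
    .cut 173, .exch 454 173 6, .exch 914 109 7, .exch 124 899 4,
    .bad 234 [(0, 5), (4, 6), (2, 7)], .bad 358 [(0, 5), (4, 6), (3, 8)],
    .bad 362 [(0, 5), (4, 6), (2, 8)], .exch 565 458 5, .bad 689 [(3, 9), (1, 5), (2, 7)],
    .exch 913 110 8, .exch 302 454 3, .exch 302 458 2, .exch 358 906 5, .exch 362 902 5,
    .bad 806 [(0, 5), (4, 8), (3, 9)], .bad 810 [(0, 5), (4, 8), (2, 9)], .cut 217, .cut 213,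
    .exch 93 721 2, .exch 124 899 4, .bad 234 [(0, 5), (4, 6), (2, 7)],
    .bad 358 [(0, 5), (4, 6), (3, 8)], .bad 362 [(0, 5), (4, 6), (2, 8)], .exch 565 458 5,
    .bad 689 [(3, 9), (1, 5), (2, 7)], .exch 913 110 8, .exch 302 454 3, .exch 302 458 2,
    .exch 358 906 5, .exch 362 902 5, .bad 806 [(0, 5), (4, 8), (3, 9)],
    .bad 810 [(0, 5), (4, 8), (2, 9)], .cut 217, .cut 213, .exch 93 721 2, .exch 451 906 0,
    .exch 454 395 2, .exch 572 451 3, .bad 678 [(0, 5), (3, 9), (4, 7)],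
    .bad 806 [(0, 5), (3, 9), (4, 8)], .bad 818 [(0, 5), (3, 9), (2, 8)], .cut 628,
    .exch 121 902 5, .bad 233 [(2, 6), (1, 5), (4, 7)], .bad 625 [(2, 6), (1, 5), (3, 9)],
    .cut 625, .exch 457 566 8, .exch 310 899 5, .cut 752, .exch 117 752 0, .cut 880,
    .exch 117 880 0, .exch 121 992 4, .bad 617 [(2, 6), (1, 5), (4, 9)], .exch 572 451 2,
    .bad 682 [(0, 5), (2, 9), (4, 7)], .bad 690 [(0, 5), (2, 9), (3, 7)],
    .bad 810 [(0, 5), (2, 9), (4, 8)], .bad 818 [(0, 5), (2, 9), (3, 8)], .exch 117 906 5,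
    .bad 229 [(3, 6), (1, 5), (4, 7)], .bad 357 [(3, 6), (1, 5), (4, 8)],
    .bad 369 [(3, 6), (1, 5), (2, 8)], .bad 613 [(3, 6), (1, 5), (4, 9)],
    .bad 625 [(3, 6), (1, 5), (2, 9)], .exch 453 570 8, .exch 453 570 7, .exch 906 117 8,
    .exch 186 906 4, .exch 906 117 9, .exch 186 458 4, .exch 314 458 4,
    .bad 234 [(0, 5), (2, 7), (4, 6)], .bad 362 [(0, 5), (2, 8), (4, 6)], .cut 789, .cut 661,
    .cut 341, .exch 565 458 5, .exch 31 837 4, .cut 279, .exch 279 597 1, .exch 309 535 5,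
    .exch 117 572 0, .bad 613 [(1, 5), (3, 6), (4, 9)], .bad 625 [(1, 5), (3, 6), (2, 9)],
    .cut 395, .exch 906 117 9, .exch 31 117 1, .exch 31 121 1, .exch 31 124 0, .cut 597,
    .exch 31 597 1, .exch 91 597 1, .exch 94 597 1, .cut 345, .exch 31 345 1, .exch 87 345 1,
    .exch 94 345 1, .cut 589, .exch 31 589 1, .exch 61 589 4, .exch 285 589 4, .cut 157,
    .exch 79 157 1, .exch 87 157 1, .exch 91 157 1, .cut 914, .cut 930, .cut 841, .cut 182,
    .bad 422 [(0, 5), (3, 7), (4, 8)], .bad 678 [(0, 5), (3, 7), (4, 9)], .cut 678, .cut 422,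
    .exch 182 992 4, .exch 230 902 5, .cut 158, .cut 566, .cut 457,
    .bad 678 [(0, 5), (3, 9), (4, 7)], .bad 806 [(0, 5), (3, 9), (4, 8)], .cut 806, .cut 678,
    .exch 566 992 4, .exch 614 902 5, .exch 157 841 7, .cut 422, .exch 62 422 3,
    .bad 422 [(0, 5), (3, 8), (4, 7)], .cut 310, .exch 310 930 2,
    .bad 434 [(0, 5), (3, 8), (2, 7)], .cut 406, .exch 62 406 3, .cut 434, .exch 62 434 2,
    .exch 62 902 3, .exch 62 914 3, .exch 62 930 3, .cut 118, .exch 118 426 6,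
    .bad 613 [(1, 9), (3, 6), (4, 5)], .bad 625 [(1, 9), (3, 6), (2, 5)],
    .bad 709 [(1, 9), (3, 6), (4, 7)], .bad 837 [(1, 9), (3, 6), (4, 8)],
    .bad 849 [(1, 9), (3, 6), (2, 8)], .cut 625, .cut 613, .cut 865, .exch 117 865 2,
    .exch 597 426 4, .exch 961 62 7, .bad 440 [(0, 5), (1, 7), (2, 8)], .cut 454, .exch 62 454 3,
    .exch 62 961 3, .exch 902 121 9, .bad 625 [(3, 5), (1, 6), (2, 9)], .cut 662, .exch 62 662 3,
    .cut 678, .exch 62 678 3, .cut 690, .exch 62 690 2, .exch 62 902 3, .exch 62 914 3,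
    .exch 62 930 3, .cut 372, .cut 651, .exch 654 899 2, .exch 666 647 3, .cut 376, .cut 364,
    .exch 841 372 3, .exch 109 372 0, .bad 914 [(0, 7), (2, 9), (3, 8)], .exch 930 117 8,
    .bad 357 [(1, 8), (3, 6), (4, 5)], .bad 369 [(1, 8), (3, 6), (2, 5)], .cut 369, .cut 357,
    .cut 361, .exch 117 361 2, .cut 364, .exch 117 364 0, .exch 992 109 8, .cut 214,
    .exch 62 214 3, .exch 902 62 7, .exch 914 62 7, .cut 837, .bad 426 [(0, 5), (2, 7), (4, 8)],
    .bad 682 [(0, 5), (2, 7), (4, 9)], .cut 682, .cut 426, .exch 174 992 2, .exch 234 906 5,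
    .exch 341 841 2, .bad 422 [(0, 5), (4, 7), (3, 8)], .bad 678 [(0, 5), (4, 7), (3, 9)],
    .cut 678, .cut 422, .exch 174 992 3, .cut 310, .exch 230 310 6, .cut 566, .exch 230 566 6,
    .exch 230 790 5, .exch 333 961 2, .exch 345 837 3, .exch 457 589 7, .cut 174,
    .bad 422 [(0, 5), (4, 7), (3, 8)], .bad 678 [(0, 5), (4, 7), (3, 9)], .cut 678, .cut 422,
    .exch 174 992 3, .exch 230 902 5, .cut 426, .exch 62 426 2, .bad 426 [(0, 5), (2, 7), (4, 8)],
    .cut 186, .exch 186 930 3, .bad 434 [(0, 5), (2, 7), (3, 8)], .cut 171, .exch 62 171 2,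
    .cut 234, .exch 62 234 2, .cut 682, .exch 62 682 2, .exch 930 62 7, .cut 188, .exch 188 810 7,
    .bad 357 [(3, 6), (1, 5), (4, 8)], .bad 369 [(3, 6), (1, 5), (2, 8)],
    .bad 453 [(3, 6), (1, 7), (4, 8)], .bad 465 [(3, 6), (1, 7), (2, 8)],
    .bad 468 [(3, 6), (1, 7), (0, 8)], .bad 613 [(3, 6), (1, 5), (4, 9)],
    .bad 625 [(3, 6), (1, 5), (2, 9)], .bad 709 [(3, 6), (1, 7), (4, 9)],
    .bad 721 [(3, 6), (1, 7), (2, 9)], .bad 724 [(3, 6), (1, 7), (0, 9)], .exch 906 117 8,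
    .exch 810 213 8, .exch 906 117 9, .exch 810 213 9, .exch 182 714 5, .exch 458 738 3,
    .bad 421 [(1, 8), (3, 7), (4, 5)], .bad 677 [(1, 9), (3, 7), (4, 5)],
    .bad 689 [(1, 9), (3, 7), (2, 5)], .bad 901 [(1, 9), (3, 7), (4, 8)],
    .bad 913 [(1, 9), (3, 7), (2, 8)], .exch 405 618 4, .exch 661 362 4, .exch 661 362 2,
    .bad 428 [(1, 8), (4, 7), (0, 5)], .bad 457 [(1, 8), (4, 7), (2, 6)],
    .bad 713 [(1, 9), (4, 7), (2, 6)], .cut 566, .cut 310, .cut 790, .exch 62 790 3, .cut 818,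
    .exch 87 818 2, .exch 914 358 7, .exch 601 422 3, .exch 61 182 0, .cut 236, .exch 62 236 1,
    .cut 248, .exch 62 248 1, .cut 425, .exch 62 425 1, .cut 681, .exch 62 681 1, .exch 124 181 3,
    .exch 899 124 7, .exch 961 62 7, .bad 468 [(0, 7), (1, 6), (3, 8)],
    .bad 724 [(0, 7), (1, 6), (3, 9)], .cut 779, .cut 675, .exch 348 675 3, .cut 555,
    .exch 181 555 7, .cut 527, .exch 527 803 2, .cut 539, .exch 539 803 3, .exch 803 31 9,
    .cut 419, .exch 604 419 3, .exch 181 299 7, .exch 899 992 0, .exch 906 929 1, .exch 914 929 1,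
    .bad 357 [(1, 5), (4, 6), (3, 8)], .bad 361 [(1, 5), (4, 6), (2, 8)],
    .bad 369 [(1, 5), (3, 6), (2, 8)], .cut 675, .exch 675 902 0, .exch 675 906 0,
    .exch 675 914 0, .exch 675 962 0, .bad 837 [(1, 8), (4, 6), (3, 9)],
    .bad 841 [(1, 8), (4, 6), (2, 9)], .bad 849 [(1, 8), (3, 6), (2, 9)], .cut 174, .cut 849,
    .exch 341 961 2, .exch 345 837 3, .cut 186, .cut 182, .exch 62 690 2, .exch 62 678 3,
    .exch 62 682 2, .cut 841, .cut 837, .exch 333 961 2, .cut 678, .exch 678 899 2, .cut 682,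
    .exch 682 899 3, .cut 690, .exch 690 899 4, .exch 899 124 8, .exch 902 121 8, .exch 906 117 8,
    .exch 914 109 8, .bad 440 [(1, 5), (2, 8), (0, 7)], .bad 809 [(1, 5), (4, 8), (2, 9)],
    .bad 817 [(1, 5), (3, 8), (2, 9)], .bad 820 [(1, 5), (3, 8), (0, 9)],
    .bad 824 [(1, 5), (2, 8), (0, 9)], .cut 199, .cut 824, .exch 313 936 0, .exch 313 944 0,
    .cut 583, .cut 214, .cut 206, .exch 707 94 7, .exch 79 707 2, .exch 79 710 0, .cut 820,
    .cut 817, .exch 309 944 0, .exch 124 899 4, .exch 902 913 1, .exch 906 913 1,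
    .bad 230 [(0, 5), (4, 6), (3, 7)], .bad 234 [(0, 5), (4, 6), (2, 7)],
    .bad 358 [(0, 5), (4, 6), (3, 8)], .bad 362 [(0, 5), (4, 6), (2, 8)],
    .bad 614 [(0, 5), (4, 6), (3, 9)], .bad 618 [(0, 5), (4, 6), (2, 9)], .cut 206, .cut 334,
    .cut 433, .cut 689, .cut 817, .cut 434, .exch 434 902 4, .exch 434 906 4, .exch 434 913 1,
    .bad 613 [(4, 6), (1, 9), (3, 5)], .bad 617 [(4, 6), (1, 9), (2, 5)], .cut 620, .cut 617,
    .cut 613, .exch 992 109 9, .cut 690, .exch 433 690 0, .exch 690 899 4, .exch 690 902 4,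
    .exch 690 906 4, .bad 357 [(4, 6), (1, 8), (3, 5)], .bad 361 [(4, 6), (1, 8), (2, 5)],
    .cut 364, .cut 361, .cut 357, .exch 992 109 8, .cut 496, .cut 454, .cut 930, .exch 62 930 4,
    .exch 496 930 4, .exch 818 482 4, .exch 818 899 4, .exch 818 902 4, .exch 818 906 4,
    .bad 229 [(4, 6), (1, 7), (3, 5)], .bad 233 [(4, 6), (1, 7), (2, 5)], .cut 236, .cut 233,
    .cut 229, .cut 244, .exch 109 244 0, .exch 174 117 7, .exch 181 79 4, .exch 370 173 6,
    .exch 899 992 0, .bad 229 [(1, 5), (3, 6), (4, 7)], .bad 357 [(1, 5), (3, 6), (4, 8)],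
    .bad 454 [(0, 6), (4, 8), (3, 7)], .bad 613 [(1, 5), (3, 6), (4, 9)],
    .bad 617 [(1, 5), (2, 6), (4, 9)], .bad 625 [(1, 5), (3, 6), (2, 9)], .cut 569,
    .exch 117 906 4, .exch 121 689 3, .exch 121 817 3, .exch 902 121 9, .exch 962 422 6,
    .exch 185 541 5, .exch 313 541 5, .cut 358, .cut 230, .exch 103 482 0, .exch 206 902 3,
    .exch 496 398 6, .exch 496 902 6, .bad 625 [(1, 5), (3, 6), (2, 9)], .cut 625,
    .exch 117 689 2, .bad 689 [(1, 5), (3, 9), (2, 7)], .exch 433 992 0, .exch 31 944 1,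
    .exch 206 944 1, .exch 213 930 4, .exch 818 916 1, .exch 818 920 1,
    .bad 229 [(4, 6), (1, 7), (3, 5)], .bad 233 [(4, 6), (1, 7), (2, 5)], .cut 233, .cut 229,
    .exch 61 199 5, .exch 103 481 1, .exch 109 227 2, .exch 913 110 7,
    .bad 422 [(0, 5), (4, 7), (3, 8)], .bad 678 [(0, 5), (4, 7), (3, 9)], .cut 678, .cut 422,
    .exch 62 902 5, .exch 174 806 3, .exch 913 110 8, .bad 422 [(0, 5), (4, 8), (3, 7)],
    .bad 806 [(0, 5), (4, 8), (3, 9)], .cut 806, .cut 422, .exch 62 902 5, .exch 302 678 3,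
    .exch 913 110 9, .bad 678 [(0, 5), (4, 9), (3, 7)], .bad 806 [(0, 5), (4, 9), (3, 8)],
    .cut 806, .cut 678, .exch 62 902 5, .exch 422 558 7, .exch 913 110 8,
    .bad 422 [(0, 5), (4, 8), (3, 7)], .bad 806 [(0, 5), (4, 8), (3, 9)], .cut 806, .cut 422,
    .exch 110 902 5, .exch 913 110 7, .bad 422 [(0, 5), (4, 7), (3, 8)],
    .bad 678 [(0, 5), (4, 7), (3, 9)], .cut 678, .cut 422, .exch 110 902 5, .cut 205,
    .exch 31 205 1, .cut 213, .exch 31 213 1, .cut 217, .exch 31 217 1, .cut 220, .exch 31 220 0,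
    .exch 899 124 7, .exch 188 285 5, .bad 428 [(0, 5), (1, 7), (4, 8)],
    .bad 436 [(0, 5), (1, 7), (3, 8)], .bad 440 [(0, 5), (1, 7), (2, 8)],
    .bad 684 [(0, 5), (1, 7), (4, 9)], .bad 692 [(0, 5), (1, 7), (3, 9)],
    .bad 696 [(0, 5), (1, 7), (2, 9)], .cut 838, .cut 173, .cut 842, .cut 850, .cut 181,
    .exch 181 285 5, .cut 185, .exch 31 185 1, .cut 914, .cut 837, .cut 186,
    .bad 426 [(0, 5), (2, 7), (4, 8)], .bad 682 [(0, 5), (2, 7), (4, 9)], .cut 682, .cut 426,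
    .exch 186 842 4, .exch 234 906 5, .exch 62 155 2, .cut 583, .cut 440, .exch 185 906 0,
    .exch 185 914 0, .exch 285 696 8, .cut 628, .cut 620, .exch 583 124 9, .exch 837 124 9,
    .exch 992 124 9, .exch 103 632 2, .exch 357 632 2, .bad 920 [(0, 7), (1, 8), (2, 9)],
    .exch 79 835 2, .exch 79 838 0, .exch 87 587 2, .cut 436, .cut 428, .cut 421, .exch 188 421 3,
    .exch 992 405 5, .bad 433 [(2, 5), (1, 7), (3, 8)], .exch 333 835 2, .exch 541 327 9,
    .cut 696, .cut 440, .cut 920, .exch 61 920 5, .exch 185 914 0, .exch 185 992 0,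
    .exch 248 913 6, .cut 775, .cut 789, .exch 789 838 0, .cut 781, .exch 781 838 0,
    .exch 902 541 8, .exch 902 285 9, .exch 285 976 3, .cut 632, .cut 376, .exch 61 856 5,
    .exch 850 899 4, .exch 850 902 4, .exch 850 906 4, .bad 229 [(1, 5), (4, 7), (3, 6)],
    .bad 233 [(1, 5), (4, 7), (2, 6)], .cut 236, .cut 233, .cut 229, .exch 850 173 6,
    .exch 121 173 4, .exch 188 835 2, .exch 233 186 0, .bad 426 [(0, 5), (2, 7), (4, 8)],
    .bad 682 [(0, 5), (2, 7), (4, 9)], .cut 682, .cut 426, .exch 171 842 0, .exch 234 906 5,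
    .exch 117 173 4, .exch 188 835 3, .exch 229 182 0, .bad 422 [(0, 5), (3, 7), (4, 8)],
    .bad 678 [(0, 5), (3, 7), (4, 9)], .cut 678, .cut 422, .exch 167 838 0, .exch 230 902 5,
    .exch 188 835 4, .bad 422 [(0, 5), (4, 7), (3, 8)], .bad 678 [(0, 5), (4, 7), (3, 9)],
    .cut 678, .cut 422, .exch 174 838 3, .exch 230 902 5, .exch 835 906 0, .exch 838 779 2,
    .bad 229 [(1, 5), (3, 6), (4, 7)], .bad 241 [(1, 5), (3, 6), (2, 7)], .cut 244, .cut 241,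
    .exch 906 117 7, .exch 188 835 4, .bad 422 [(0, 5), (4, 7), (3, 8)],
    .bad 678 [(0, 5), (4, 7), (3, 9)], .cut 678, .cut 422, .exch 174 838 3, .exch 230 902 5,
    .exch 835 902 0, .bad 233 [(1, 5), (2, 6), (4, 7)], .bad 241 [(1, 5), (3, 6), (2, 7)],
    .cut 248, .exch 902 121 7, .cut 79, .exch 79 541 1, .cut 109, .exch 109 541 5, .cut 205,
    .exch 205 541 6, .exch 124 899 4, .exch 285 110 0, .bad 230 [(0, 5), (4, 6), (3, 7)],
    .bad 234 [(0, 5), (4, 6), (2, 7)], .bad 358 [(0, 5), (4, 6), (3, 8)],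
    .bad 362 [(0, 5), (4, 6), (2, 8)], .bad 614 [(0, 5), (4, 6), (3, 9)],
    .bad 618 [(0, 5), (4, 6), (2, 9)], .cut 817, .cut 143, .exch 87 143 4, .exch 91 143 4,
    .exch 94 143 4, .cut 803, .cut 433, .cut 419, .cut 334, .exch 31 334 0, .cut 654, .cut 849,
    .cut 174, .bad 422 [(0, 5), (4, 7), (3, 8)], .bad 426 [(0, 5), (4, 7), (2, 8)], .cut 426,
    .cut 422, .exch 174 419 2, .exch 47 654 0, .exch 62 143 4, .cut 465,
    .bad 678 [(0, 5), (4, 9), (3, 7)], .bad 682 [(0, 5), (4, 9), (2, 7)], .cut 682, .cut 678,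
    .exch 419 558 7, .exch 341 433 2, .exch 345 405 3, .cut 618, .cut 614, .exch 803 110 9,
    .exch 992 110 9, .exch 355 620 1, .bad 906 [(0, 7), (4, 9), (2, 8)], .exch 341 817 2,
    .exch 345 789 3, .cut 234, .cut 230, .cut 227, .exch 110 227 2, .exch 992 203 5,
    .bad 369 [(1, 5), (2, 6), (3, 8)], .exch 143 902 0, .exch 143 906 0, .cut 376, .cut 372,
    .cut 369, .exch 124 369 2, .exch 817 124 8, .exch 992 121 8,
    .bad 906 [(4, 8), (0, 7), (2, 9)], .exch 913 110 8, .bad 422 [(0, 5), (4, 8), (3, 7)],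
    .bad 426 [(0, 5), (4, 8), (2, 7)], .cut 426, .cut 422, .exch 302 419 2, .exch 899 124 9,
    .bad 820 [(0, 5), (1, 9), (3, 8)], .bad 824 [(0, 5), (1, 9), (2, 8)], .cut 824, .cut 820,
    .exch 572 817 2, .exch 913 110 9, .exch 465 817 6, .bad 678 [(0, 5), (4, 9), (3, 7)],
    .bad 682 [(0, 5), (4, 9), (2, 7)], .cut 682, .cut 678, .exch 558 902 3, .exch 992 654 5,
    .bad 369 [(1, 5), (2, 6), (3, 8)], .exch 817 899 4, .bad 460 [(0, 6), (4, 7), (1, 8)],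
    .bad 716 [(0, 6), (4, 7), (1, 9)], .cut 236, .exch 206 817 1, .cut 206, .exch 31 206 0,
    .exch 913 110 7, .bad 422 [(0, 5), (4, 7), (3, 8)], .bad 678 [(0, 5), (4, 7), (3, 9)],
    .cut 678, .cut 422, .exch 47 902 5, .exch 913 110 7, .bad 422 [(0, 5), (4, 7), (3, 8)],
    .bad 678 [(0, 5), (4, 7), (3, 9)], .cut 678, .cut 422, .exch 47 902 5, .exch 174 806 3,
    .cut 285, .exch 91 285 1, .cut 341, .exch 91 341 1, .cut 348, .exch 91 348 0, .exch 899 124 8,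
    .exch 31 316 0, .bad 428 [(0, 5), (1, 8), (4, 7)], .bad 436 [(0, 5), (1, 8), (3, 7)],
    .bad 440 [(0, 5), (1, 8), (2, 7)], .bad 812 [(0, 5), (1, 8), (4, 9)],
    .bad 820 [(0, 5), (1, 8), (3, 9)], .bad 824 [(0, 5), (1, 8), (2, 9)], .cut 710, .cut 714,
    .cut 279, .exch 61 279 3, .exch 279 541 1, .cut 914, .cut 283, .exch 61 283 2,
    .exch 283 541 1, .cut 79, .exch 61 79 4, .cut 722, .cut 301, .exch 31 301 1, .cut 213,
    .exch 79 213 1, .exch 213 271 7, .exch 213 279 6, .exch 213 286 7, .cut 709, .cut 314,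
    .bad 426 [(0, 5), (2, 8), (4, 7)], .bad 810 [(0, 5), (2, 8), (4, 9)], .cut 810, .cut 426,
    .exch 314 714 4, .exch 362 906 5, .exch 62 283 2, .cut 583, .cut 440, .exch 313 906 0,
    .exch 313 914 0, .exch 397 824 7, .cut 628, .cut 620, .exch 583 124 9, .exch 709 124 9,
    .exch 992 124 9, .exch 103 632 2, .exch 229 632 2, .bad 920 [(0, 8), (1, 7), (2, 9)],
    .exch 79 707 2, .exch 79 710 0, .exch 87 587 2, .cut 436, .cut 428, .cut 421, .exch 316 421 3,
    .exch 992 405 5, .bad 433 [(2, 5), (1, 8), (3, 7)], .exch 205 707 2, .exch 541 199 9,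
    .cut 824, .cut 440, .cut 920, .exch 61 920 5, .exch 313 914 0, .exch 313 992 0,
    .exch 376 913 6, .cut 647, .cut 661, .exch 661 710 0, .cut 653, .exch 653 710 0,
    .exch 902 157 9, .exch 391 583 7, .exch 157 976 3, .cut 632, .cut 248, .exch 61 728 5,
    .cut 220, .exch 87 220 0, .cut 397, .exch 87 397 1, .cut 412, .exch 87 412 1, .exch 899 124 7,
    .cut 436, .cut 587, .exch 79 707 2, .exch 91 583 3, .cut 440, .cut 428, .cut 908,
    .exch 908 309 9, .exch 188 906 2, .exch 313 398 0, .exch 395 188 8, .exch 902 188 8,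
    .exch 914 188 8, .cut 595, .cut 583, .exch 87 707 2, .exch 109 309 3, .exch 109 313 2,
    .exch 316 707 4, .exch 357 302 0, .exch 361 295 3, .bad 422 [(0, 5), (4, 8), (3, 7)],
    .bad 426 [(0, 5), (4, 8), (2, 7)], .bad 806 [(0, 5), (4, 8), (3, 9)],
    .bad 810 [(0, 5), (4, 8), (2, 9)], .cut 426, .cut 422, .exch 121 902 5, .exch 295 932 0,
    .exch 299 932 1, .cut 419, .exch 302 419 2, .exch 302 421 1, .exch 906 295 7, .exch 992 391 5,
    .bad 421 [(1, 5), (3, 8), (4, 7)], .bad 425 [(1, 5), (2, 8), (4, 7)], .cut 602, .cut 598,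
    .cut 595, .cut 213, .cut 205, .exch 117 205 4, .exch 722 109 7, .exch 316 707 4,
    .exch 707 914 0, .exch 710 659 2, .exch 714 659 3, .bad 241 [(1, 5), (3, 6), (2, 7)],
    .bad 357 [(1, 5), (3, 8), (4, 6)], .bad 361 [(1, 5), (2, 8), (4, 6)],
    .bad 810 [(0, 5), (4, 8), (2, 9)], .cut 364, .cut 361, .cut 357, .cut 453, .exch 61 453 5,
    .cut 481, .exch 109 481 2, .cut 229, .exch 229 961 2, .cut 488, .exch 488 117 7,
    .exch 906 117 7, .exch 842 313 6, .exch 109 961 2, .exch 233 376 0, .cut 109, .exch 31 109 1,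
    .exch 124 899 4, .exch 541 110 0, .exch 597 47 6, .bad 230 [(0, 5), (4, 6), (3, 7)],
    .bad 234 [(0, 5), (4, 6), (2, 7)], .bad 614 [(0, 5), (4, 6), (3, 9)], .cut 234, .cut 230,
    .exch 103 710 0, .cut 227, .exch 110 227 2, .exch 313 710 5, .exch 740 110 7, .exch 992 199 5,
    .bad 229 [(1, 5), (3, 6), (4, 7)], .cut 794, .cut 787, .exch 283 914 0, .cut 313,
    .exch 31 313 1, .exch 91 309 6, .exch 316 707 2, .exch 369 314 0, .exch 541 307 3,
    .bad 426 [(0, 5), (2, 8), (4, 7)], .bad 810 [(0, 5), (2, 8), (4, 9)], .cut 426,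
    .exch 59 906 5, .exch 117 906 5, .bad 229 [(3, 6), (1, 5), (4, 7)], .cut 213, .cut 205,
    .exch 117 205 4, .cut 453, .exch 117 453 4, .exch 709 314 9, .exch 124 899 4,
    .bad 234 [(0, 5), (4, 6), (2, 7)], .bad 618 [(0, 5), (4, 6), (2, 9)], .cut 234,
    .exch 110 714 2, .exch 309 714 5, .bad 433 [(3, 8), (1, 5), (2, 7)], .cut 405, .cut 465,
    .exch 309 465 2, .cut 409, .exch 309 409 2, .exch 913 110 9, .cut 309, .exch 31 309 1,
    .exch 316 707 3, .exch 541 310 0, .bad 422 [(0, 5), (3, 8), (4, 7)],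
    .bad 806 [(0, 5), (3, 8), (4, 9)], .cut 422, .exch 55 902 5, .exch 121 902 5,
    .bad 233 [(2, 6), (1, 5), (4, 7)], .cut 217, .cut 205, .exch 121 205 4, .cut 457,
    .exch 121 457 4, .exch 713 310 9, .exch 707 906 0, .exch 710 651 2,
    .bad 357 [(1, 5), (3, 6), (4, 8)], .bad 369 [(1, 5), (3, 6), (2, 8)], .cut 372, .cut 369,
    .exch 906 117 8, .exch 707 902 0, .bad 361 [(1, 5), (2, 6), (4, 8)],
    .bad 369 [(1, 5), (3, 6), (2, 8)], .cut 376, .exch 902 121 8, .cut 541, .exch 87 541 1,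
    .cut 589, .exch 87 589 1, .cut 601, .exch 87 601 1, .cut 604, .exch 87 604 0, .exch 899 124 9,
    .exch 31 572 0, .bad 684 [(0, 5), (1, 9), (4, 7)], .bad 692 [(0, 5), (1, 9), (3, 7)],
    .bad 696 [(0, 5), (1, 9), (2, 7)], .bad 812 [(0, 5), (1, 9), (4, 8)],
    .bad 820 [(0, 5), (1, 9), (3, 8)], .bad 824 [(0, 5), (1, 9), (2, 8)], .cut 454, .cut 466,
    .cut 458, .cut 535, .exch 61 535 3, .cut 569, .exch 31 569 1, .cut 527, .exch 61 527 4,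
    .cut 109, .exch 31 109 1, .cut 914, .cut 285, .exch 87 285 1, .exch 91 285 1, .cut 665,
    .exch 79 665 1, .exch 87 665 1, .exch 527 665 1, .exch 535 665 1, .exch 542 665 1, .cut 453,
    .cut 570, .bad 682 [(0, 5), (2, 9), (4, 7)], .bad 810 [(0, 5), (2, 9), (4, 8)], .cut 810,
    .cut 682, .exch 570 458 4, .exch 618 906 5, .exch 62 539 2, .cut 327, .cut 696,
    .exch 569 906 0, .exch 569 914 0, .exch 653 824 7, .cut 372, .cut 364, .exch 327 124 8,
    .exch 453 124 8, .exch 992 124 8, .exch 103 376 2, .exch 229 376 2,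
    .bad 920 [(0, 9), (1, 7), (2, 8)], .exch 79 451 2, .exch 79 454 0, .exch 87 331 2, .cut 692,
    .cut 684, .cut 677, .exch 572 677 3, .exch 992 661 5, .bad 689 [(2, 5), (1, 9), (3, 7)],
    .exch 205 451 2, .exch 285 199 8, .cut 824, .cut 696, .cut 920, .exch 61 920 5,
    .exch 569 914 0, .exch 569 992 0, .exch 632 913 6, .cut 391, .cut 405, .exch 405 454 0,
    .exch 199 899 2, .cut 901, .exch 199 901 1, .exch 285 647 8, .exch 157 976 3, .cut 376,
    .cut 248, .exch 61 472 5, .cut 157, .exch 157 539 2, .cut 220, .exch 220 539 7, .cut 653,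
    .exch 345 653 4, .cut 668, .exch 345 668 0, .exch 899 124 7, .cut 327, .cut 696,
    .exch 906 188 9, .exch 914 188 9, .cut 339, .cut 331, .exch 91 327 3, .exch 79 451 2,
    .exch 87 331 2, .cut 692, .cut 684, .cut 908, .exch 908 569 8, .exch 188 902 3,
    .exch 565 654 0, .exch 647 188 9, .cut 348, .exch 31 348 0, .cut 781, .exch 31 781 1,
    .cut 789, .exch 31 789 1, .cut 796, .exch 31 796 0, .exch 899 124 8, .exch 527 316 1,
    .cut 199, .cut 824, .exch 906 316 9, .exch 914 316 9, .cut 211, .cut 203, .exch 91 199 3,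
    .exch 79 451 2, .exch 87 203 2, .cut 820, .cut 812, .exch 286 565 8, .cut 805,
    .exch 316 805 3, .exch 902 309 9, .exch 124 899 4, .exch 466 899 4, .exch 466 902 4,
    .exch 466 906 4, .bad 230 [(0, 5), (4, 6), (3, 7)], .bad 358 [(0, 5), (4, 6), (3, 8)],
    .bad 613 [(1, 5), (4, 9), (3, 6)], .bad 617 [(1, 5), (4, 9), (2, 6)], .cut 620, .cut 617,
    .cut 613, .cut 709, .exch 61 709 5, .cut 737, .exch 109 737 2, .cut 740, .exch 109 740 0,
    .cut 229, .exch 229 961 2, .cut 484, .exch 484 539 8, .cut 230, .exch 230 961 1,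
    .exch 569 454 5, .exch 87 557 6, .exch 91 557 6, .exch 94 557 6, .exch 124 899 4,
    .bad 230 [(0, 5), (4, 6), (3, 7)], .bad 234 [(0, 5), (4, 6), (2, 7)],
    .bad 358 [(0, 5), (4, 6), (3, 8)], .bad 362 [(0, 5), (4, 6), (2, 8)], .cut 403,
    .exch 569 454 5, .exch 565 458 5, .bad 613 [(3, 9), (1, 5), (4, 6)],
    .bad 617 [(2, 9), (1, 5), (4, 6)], .cut 410, .cut 406, .exch 466 557 6, .cut 557,
    .exch 31 557 1, .exch 572 451 4, .exch 31 558 0, .bad 678 [(0, 5), (4, 9), (3, 7)],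
    .bad 682 [(0, 5), (4, 9), (2, 7)], .bad 806 [(0, 5), (4, 9), (3, 8)],
    .bad 810 [(0, 5), (4, 9), (2, 8)], .exch 121 902 5, .exch 117 906 5,
    .bad 361 [(2, 6), (1, 5), (4, 8)], .bad 369 [(3, 6), (1, 5), (2, 8)], .exch 902 121 8,
    .exch 465 558 7, .exch 849 121 8, .exch 569 849 3, .bad 230 [(0, 5), (4, 7), (3, 6)],
    .cut 678, .cut 230, .exch 47 710 5, .exch 174 614 3, .exch 121 565 3, .exch 121 572 0,
    .exch 572 451 2, .bad 682 [(0, 5), (2, 9), (4, 7)], .bad 810 [(0, 5), (2, 9), (4, 8)],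
    .bad 818 [(0, 5), (2, 9), (3, 8)], .cut 391, .exch 117 906 5,
    .bad 229 [(3, 6), (1, 5), (4, 7)], .bad 625 [(3, 6), (1, 5), (2, 9)], .cut 398,
    .exch 453 570 8, .exch 709 117 7, .cut 271, .exch 271 902 0, .cut 143, .exch 143 902 0,
    .exch 31 458 4, .bad 613 [(3, 6), (1, 5), (4, 9)], .cut 565, .exch 31 565 1, .exch 87 572 6,
    .exch 572 451 3, .exch 87 566 0, .bad 614 [(0, 5), (3, 9), (4, 6)],
    .bad 678 [(0, 5), (3, 9), (4, 7)], .bad 690 [(0, 5), (3, 9), (2, 7)],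
    .bad 806 [(0, 5), (3, 9), (4, 8)], .cut 395, .exch 121 902 5,
    .bad 361 [(2, 6), (1, 5), (4, 8)], .bad 369 [(2, 6), (1, 5), (3, 8)],
    .bad 625 [(2, 6), (1, 5), (3, 9)], .exch 457 566 7, .exch 841 121 8, .exch 902 121 8,
    .exch 906 117 9, .exch 410 457 1, .cut 678, .cut 614, .exch 55 710 5, .exch 451 906 0,
    .exch 454 395 2, .exch 466 395 4, .exch 572 451 3, .bad 233 [(1, 5), (2, 6), (4, 7)],
    .bad 613 [(1, 5), (3, 6), (4, 9)], .bad 625 [(1, 5), (3, 6), (2, 9)],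
    .bad 806 [(0, 5), (3, 9), (4, 8)], .bad 818 [(0, 5), (3, 9), (2, 8)], .cut 625, .cut 613,
    .exch 457 566 8, .exch 713 117 9, .exch 572 451 4, .bad 678 [(0, 5), (4, 9), (3, 7)],
    .bad 682 [(0, 5), (4, 9), (2, 7)], .bad 806 [(0, 5), (4, 9), (3, 8)],
    .bad 810 [(0, 5), (4, 9), (2, 8)], .exch 121 902 5, .exch 117 906 5,
    .bad 361 [(2, 6), (1, 5), (4, 8)], .bad 369 [(3, 6), (1, 5), (2, 8)],
    .bad 617 [(2, 6), (1, 5), (4, 9)], .bad 625 [(3, 6), (1, 5), (2, 9)], .exch 902 121 8,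
    .exch 465 558 7, .exch 849 121 8, .exch 902 121 9, .exch 569 849 3,
    .bad 230 [(0, 5), (4, 7), (3, 6)], .cut 678, .cut 230, .exch 62 710 5, .exch 174 614 3,
    .exch 451 902 0, .bad 617 [(1, 5), (2, 6), (4, 9)], .bad 625 [(1, 5), (3, 6), (2, 9)],
    .cut 632, .exch 902 121 9]

theorem chainThreeStepsFirst_run :
    run 3 chainThreeStepsFirst [start [31, 62, 124, 121, 117]] = true := by
  decide +kernel

/-- Certificate for three consecutive exchanges, if after the exchanges of `0` for `5` and of `1` for
`6` both `2` and `3` can be exchanged for `1`. -/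
def chainThreeStepsSecond : List Step :=
  [.bad 230 [(0, 5), (3, 6), (4, 7)], .bad 234 [(0, 5), (2, 6), (4, 7)],
    .bad 236 [(0, 5), (1, 6), (4, 7)], .bad 242 [(0, 5), (3, 6), (2, 7)],
    .bad 244 [(0, 5), (3, 6), (1, 7)], .bad 248 [(0, 5), (2, 6), (1, 7)],
    .bad 358 [(0, 5), (3, 6), (4, 8)], .bad 362 [(0, 5), (2, 6), (4, 8)],
    .bad 364 [(0, 5), (1, 6), (4, 8)], .bad 370 [(0, 5), (3, 6), (2, 8)],
    .bad 372 [(0, 5), (3, 6), (1, 8)], .bad 376 [(0, 5), (2, 6), (1, 8)],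
    .bad 614 [(0, 5), (3, 6), (4, 9)], .bad 618 [(0, 5), (2, 6), (4, 9)],
    .bad 620 [(0, 5), (1, 6), (4, 9)], .bad 626 [(0, 5), (3, 6), (2, 9)],
    .bad 628 [(0, 5), (3, 6), (1, 9)], .bad 632 [(0, 5), (2, 6), (1, 9)], .cut 913, .cut 110,
    .cut 94, .cut 302, .cut 314, .cut 310, .cut 316, .cut 286, .cut 572, .cut 570, .cut 558,
    .cut 566, .cut 542, .cut 182, .cut 186, .cut 174, .cut 188, .cut 158, .cut 55, .cut 59,
    .cut 47, .cut 61, .cut 837, .bad 426 [(0, 5), (2, 7), (4, 8)],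
    .bad 434 [(0, 5), (2, 7), (3, 8)], .bad 440 [(0, 5), (2, 7), (1, 8)],
    .bad 682 [(0, 5), (2, 7), (4, 9)], .bad 690 [(0, 5), (2, 7), (3, 9)],
    .bad 696 [(0, 5), (2, 7), (1, 9)], .cut 835, .bad 428 [(0, 5), (1, 7), (4, 8)],
    .bad 436 [(0, 5), (1, 7), (3, 8)], .bad 684 [(0, 5), (1, 7), (4, 9)],
    .bad 692 [(0, 5), (1, 7), (3, 9)], .cut 841, .bad 422 [(0, 5), (3, 7), (4, 8)],
    .bad 678 [(0, 5), (3, 7), (4, 9)], .cut 849, .cut 721, .bad 806 [(0, 5), (4, 8), (3, 9)],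
    .bad 810 [(0, 5), (4, 8), (2, 9)], .bad 812 [(0, 5), (4, 8), (1, 9)], .cut 707,
    .bad 820 [(0, 5), (1, 8), (3, 9)], .cut 709, .bad 818 [(0, 5), (2, 8), (3, 9)], .cut 713,
    .cut 465, .cut 451, .cut 457, .cut 453, .cut 962, .cut 234, .cut 789, .cut 362, .cut 661,
    .exch 31 901 4, .exch 405 709 4, .cut 810, .cut 618, .exch 362 558 6, .exch 234 302 6,
    .cut 597, .exch 31 837 4, .exch 341 709 4, .cut 810, .cut 682, .exch 426 558 7, .cut 362,
    .exch 174 362 2, .cut 661, .cut 597, .exch 31 709 4, .exch 213 901 4, .cut 810, .cut 618,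
    .exch 362 558 6, .cut 426, .exch 110 426 2, .exch 110 962 2, .exch 302 618 2, .exch 174 810 2,
    .cut 405, .cut 341, .cut 213, .exch 31 453 4, .exch 451 992 0, .exch 482 707 5,
    .exch 482 835 5, .cut 230, .cut 793, .cut 409, .exch 409 841 4, .cut 678, .cut 614,
    .exch 230 558 6, .exch 31 905 4, .cut 283, .exch 283 665 1, .exch 457 665 6, .cut 806,
    .cut 358, .exch 31 866 2, .exch 47 838 5, .exch 302 614 3, .exch 110 482 2, .exch 110 738 2,
    .exch 118 234 2, .exch 174 358 3, .exch 174 614 3, .cut 789, .cut 781, .cut 601, .cut 345,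
    .cut 93, .exch 93 913 2, .exch 837 31 6, .exch 451 837 1, .exch 451 901 1, .exch 457 327 3,
    .exch 457 391 3, .exch 465 327 4, .exch 465 391 4, .exch 558 465 2, .exch 837 186 9, .cut 696,
    .cut 690, .cut 682, .cut 632, .cut 626, .cut 618, .cut 611, .exch 122 611 3, .cut 227,
    .exch 227 570 7, .exch 357 707 5, .cut 738, .exch 555 738 0, .exch 570 737 1, .exch 451 713 1,
    .exch 451 841 1, .exch 451 905 1, .exch 465 203 4, .exch 465 331 4, .exch 465 395 4,
    .exch 558 465 3, .exch 572 451 3, .exch 713 310 9, .exch 713 458 0, .exch 961 233 8,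
    .bad 611 [(3, 5), (4, 9), (2, 6)], .bad 613 [(3, 5), (4, 9), (1, 6)], .cut 820, .cut 806,
    .cut 692, .cut 678, .cut 628, .cut 614, .exch 472 551 6, .cut 738, .exch 551 738 0, .cut 866,
    .exch 551 866 0, .cut 737, .exch 566 737 1, .cut 865, .exch 566 865 1, .cut 611,
    .exch 611 481 1, .cut 613, .exch 613 451 2, .exch 992 103 9, .exch 465 835 4, .exch 465 899 4,
    .exch 558 465 1, .exch 707 466 0, .bad 613 [(1, 5), (4, 9), (3, 6)],
    .bad 617 [(1, 5), (4, 9), (2, 6)], .cut 812, .cut 684, .cut 620, .exch 466 557 6, .cut 740,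
    .exch 557 740 0, .cut 868, .exch 557 868 0, .cut 613, .exch 613 992 0, .exch 709 557 6,
    .cut 844, .exch 844 677 6, .cut 872, .exch 872 677 6, .exch 992 109 9, .cut 364,
    .exch 914 364 9, .exch 484 617 7, .exch 557 744 0, .exch 721 302 9, .exch 849 174 9,
    .exch 913 110 9, .exch 961 241 8, .bad 710 [(0, 9), (4, 7), (3, 6)],
    .bad 714 [(0, 9), (4, 7), (2, 6)], .bad 838 [(0, 9), (4, 8), (3, 6)],
    .bad 842 [(0, 9), (4, 8), (2, 6)], .exch 590 433 3, .exch 590 433 2, .cut 583, .cut 440,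
    .exch 188 425 2, .exch 188 433 2, .cut 838, .cut 595, .cut 587, .exch 583 782 0,
    .exch 775 602 0, .exch 590 707 2, .exch 590 709 1, .cut 436, .cut 434, .exch 182 433 1,
    .exch 302 721 3, .exch 707 841 1, .exch 707 905 1, .exch 709 587 2, .exch 709 651 2,
    .exch 721 587 4, .exch 721 651 4, .cut 434, .cut 422, .cut 370, .cut 358, .cut 355,
    .exch 118 355 2, .exch 122 295 6, .cut 227, .exch 227 310 7, .cut 451, .exch 451 103 7,
    .exch 835 188 9, .exch 302 721 2, .exch 707 837 1, .exch 707 901 1, .exch 721 583 4,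
    .exch 721 647 4, .cut 440, .cut 426, .cut 376, .cut 362, .cut 482, .exch 299 482 0, .cut 481,
    .exch 314 481 1, .cut 355, .exch 355 992 0, .cut 358, .exch 358 299 2, .cut 370,
    .exch 370 47 4, .exch 835 188 9, .cut 866, .exch 866 31 9, .cut 868, .exch 868 451 5,
    .cut 872, .exch 872 451 5, .cut 880, .exch 880 451 5, .exch 992 542 7, .exch 302 721 1,
    .exch 721 899 4, .exch 722 835 4, .exch 835 188 8, .exch 899 124 8, .exch 961 611 7,
    .bad 357 [(1, 5), (4, 8), (3, 6)], .bad 361 [(1, 5), (4, 8), (2, 6)],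
    .bad 468 [(0, 8), (1, 7), (3, 6)], .cut 428, .cut 364, .cut 484, .exch 301 484 0,
    .exch 837 186 9, .cut 488, .exch 301 488 0, .exch 841 182 9, .cut 460, .exch 301 460 0,
    .exch 348 453 3, .exch 348 457 2, .exch 348 992 4, .cut 527, .exch 527 496 2, .cut 555,
    .exch 47 611 2, .exch 551 472 5, .exch 849 174 8, .exch 961 625 7,
    .bad 454 [(0, 8), (4, 7), (3, 6)], .bad 460 [(0, 8), (4, 7), (1, 6)],
    .bad 902 [(0, 8), (4, 7), (3, 9)], .bad 908 [(0, 8), (4, 7), (1, 9)], .exch 398 625 3,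
    .exch 398 625 1, .cut 391, .cut 632, .exch 122 617 1, .exch 122 625 1, .cut 902, .cut 405,
    .cut 397, .exch 899 412 0, .exch 398 899 2, .exch 398 901 1, .cut 628, .cut 626,
    .exch 118 625 1, .exch 182 841 4, .exch 835 913 1, .exch 837 787 2, .exch 841 787 3, .cut 236,
    .cut 234, .cut 230, .cut 227, .exch 110 227 2, .exch 122 167 6, .cut 242, .exch 167 242 0,
    .cut 482, .exch 167 482 0, .cut 738, .exch 167 738 0, .cut 241, .exch 174 241 1, .cut 481,
    .exch 174 481 1, .cut 737, .exch 174 737 1, .cut 229, .exch 229 787 2, .exch 992 103 7,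
    .exch 186 837 3, .exch 188 835 3, .exch 835 905 1, .exch 837 779 2, .exch 842 905 1,
    .exch 905 118 7, .exch 961 809 6, .bad 227 [(3, 5), (2, 7), (4, 6)],
    .bad 419 [(3, 5), (2, 7), (4, 8)], .bad 421 [(3, 5), (1, 7), (4, 8)],
    .bad 433 [(3, 5), (2, 7), (1, 8)], .bad 454 [(0, 7), (3, 6), (4, 8)],
    .bad 466 [(0, 7), (3, 6), (2, 8)], .bad 468 [(0, 7), (3, 6), (1, 8)],
    .bad 677 [(3, 5), (1, 7), (4, 9)], .bad 689 [(3, 5), (2, 7), (1, 9)],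
    .bad 722 [(0, 7), (3, 6), (2, 9)], .cut 244, .cut 242, .cut 241, .exch 118 241 1, .cut 496,
    .exch 179 496 0, .cut 752, .exch 179 752 0, .exch 992 179 6, .exch 844 179 8, .exch 842 181 8,
    .exch 913 110 9, .cut 79, .exch 944 79 9, .exch 944 465 5, .cut 590, .cut 527, .exch 527 94 0,
    .cut 587, .exch 542 587 2, .cut 589, .exch 542 589 1, .exch 542 714 2, .exch 542 716 1,
    .exch 542 837 4, .exch 558 597 5, .exch 558 602 2, .exch 602 781 4, .exch 604 779 4,
    .exch 618 541 5, .exch 716 539 7, .cut 617, .exch 782 617 8, .exch 809 214 8, .exch 342 681 4,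
    .exch 342 681 2, .cut 482, .exch 541 482 4, .cut 466, .cut 370, .exch 651 370 7,
    .exch 850 179 9, .exch 185 613 3, .exch 781 109 8, .exch 186 837 1, .exch 838 899 2,
    .exch 899 124 7, .exch 961 803 6, .bad 433 [(1, 5), (2, 7), (3, 8)],
    .bad 468 [(0, 7), (1, 6), (3, 8)], .bad 681 [(1, 5), (2, 7), (4, 9)],
    .bad 689 [(1, 5), (2, 7), (3, 9)], .bad 724 [(0, 7), (1, 6), (3, 9)], .exch 913 110 9,
    .exch 838 185 9, .bad 809 [(1, 5), (2, 9), (4, 8)], .bad 810 [(0, 5), (4, 9), (2, 8)],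
    .exch 220 803 3, .exch 901 122 7, .exch 961 805 6, .bad 466 [(0, 7), (2, 6), (3, 8)],
    .bad 472 [(0, 7), (2, 6), (1, 8)], .bad 714 [(0, 7), (2, 6), (4, 9)],
    .bad 722 [(0, 7), (2, 6), (3, 9)], .bad 728 [(0, 7), (2, 6), (1, 9)], .cut 214, .cut 220,
    .cut 803, .bad 468 [(0, 7), (1, 6), (3, 8)], .bad 716 [(0, 7), (1, 6), (4, 9)],
    .bad 724 [(0, 7), (1, 6), (3, 9)], .cut 472, .cut 551, .exch 47 803 2, .exch 47 805 1,
    .cut 468, .cut 466, .exch 214 472 1, .cut 295, .cut 728, .exch 218 905 1, .cut 920,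
    .exch 218 920 1, .exch 218 992 1, .exch 220 905 2, .exch 220 913 2, .cut 775, .exch 295 899 2,
    .cut 327, .exch 327 805 1, .cut 838, .exch 391 838 0, .exch 805 962 5, .cut 632,
    .exch 248 570 6, .cut 602, .exch 248 602 5, .cut 604, .exch 248 604 5, .exch 217 696 0,
    .exch 94 866 2, .exch 346 665 8, .exch 793 94 9, .exch 805 218 9, .exch 803 220 9,
    .bad 682 [(0, 7), (2, 9), (4, 5)], .bad 906 [(0, 7), (2, 9), (4, 8)],
    .bad 908 [(0, 7), (1, 9), (4, 8)], .bad 916 [(0, 7), (1, 9), (3, 8)], .cut 117, .cut 115,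
    .cut 107, .exch 666 357 4, .cut 87, .exch 87 369 1, .cut 93, .exch 93 355 3, .cut 341,
    .exch 94 341 1, .exch 118 345 2, .exch 47 803 2, .exch 47 805 1, .exch 55 299 2, .cut 724,
    .cut 722, .cut 716, .cut 710, .exch 220 710 3, .exch 865 214 9, .exch 901 598 7,
    .exch 218 805 1, .exch 805 899 2, .exch 865 775 5, .bad 440 [(0, 5), (1, 7), (2, 8)],
    .bad 696 [(0, 5), (1, 7), (2, 9)], .cut 248, .exch 188 835 2, .exch 838 901 1,
    .bad 681 [(2, 5), (1, 7), (4, 9)], .exch 905 118 8, .bad 806 [(0, 5), (3, 8), (4, 9)],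
    .exch 124 218 2, .exch 899 124 7, .exch 805 835 2, .exch 118 218 2, .exch 905 118 7,
    .exch 805 841 2, .exch 31 188 0, .exch 31 316 0, .cut 614, .cut 409, .exch 157 905 2,
    .exch 157 913 2, .cut 626, .cut 618, .exch 122 614 3, .cut 358, .cut 665, .exch 157 905 2,
    .exch 157 913 2, .cut 370, .cut 362, .exch 122 358 3, .exch 110 992 3, .cut 793,
    .exch 285 905 2, .exch 285 913 2, .cut 242, .cut 234, .exch 122 230 3, .exch 31 174 0,
    .exch 31 302 0, .cut 626, .cut 397, .exch 143 901 1, .exch 143 905 1, .cut 632, .cut 628,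
    .exch 124 626 2, .cut 370, .cut 653, .exch 143 901 1, .exch 143 905 1, .cut 376, .cut 372,
    .exch 124 370 2, .exch 118 992 2, .cut 781, .exch 271 901 1, .exch 271 905 1, .cut 248,
    .cut 244, .exch 124 242 2, .exch 31 186 0, .exch 31 314 0, .cut 614, .cut 409,
    .exch 155 905 1, .exch 155 913 1, .cut 628, .cut 620, .exch 124 614 3, .cut 358, .cut 665,
    .exch 155 905 1, .exch 155 913 1, .cut 372, .cut 364, .exch 124 358 3, .exch 110 992 3,
    .cut 793, .exch 283 905 1, .exch 283 913 1, .cut 244, .cut 236, .exch 124 230 3,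
    .exch 31 182 0, .exch 31 310 0, .cut 618, .cut 405, .exch 151 901 1, .exch 151 913 1,
    .cut 632, .cut 620, .exch 124 618 2, .cut 362, .cut 661, .exch 151 901 1, .exch 151 913 1,
    .cut 376, .cut 364, .exch 124 362 2, .exch 110 992 2, .cut 789, .exch 279 901 1,
    .exch 279 913 1, .cut 248, .cut 236, .exch 124 234 2, .exch 31 182 0, .exch 31 186 0,
    .exch 31 188 0, .cut 614, .cut 409, .exch 155 905 1, .exch 155 913 1, .cut 628, .cut 620,
    .exch 124 614 3, .cut 618, .exch 118 618 2, .cut 405, .cut 397, .exch 151 901 1,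
    .exch 157 391 3, .cut 626, .exch 110 626 2, .exch 992 110 9, .exch 992 122 9, .cut 403,
    .cut 391, .exch 151 899 2, .exch 124 174 4, .exch 124 182 3, .exch 124 186 2, .exch 899 124 7,
    .cut 787, .cut 779, .cut 775, .exch 803 31 5, .exch 110 182 3, .exch 110 186 2,
    .exch 913 110 7, .cut 793, .cut 789, .exch 817 31 5, .exch 787 901 1, .cut 248, .cut 236,
    .exch 124 234 2, .exch 122 182 3, .exch 901 122 7, .cut 781, .exch 805 905 2, .cut 789,
    .exch 789 809 2, .cut 234, .cut 230, .exch 110 242 2, .cut 285, .exch 285 805 3, .cut 541,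
    .exch 541 805 3, .exch 805 31 5, .exch 31 809 1, .cut 248, .cut 244, .exch 124 242 2,
    .exch 905 118 7, .exch 214 566 6, .cut 362, .cut 661, .exch 662 901 1, .exch 662 913 1,
    .cut 376, .cut 364, .exch 124 362 2, .cut 358, .exch 122 358 3, .cut 665, .cut 653,
    .exch 905 31 8, .exch 651 901 1, .cut 376, .cut 372, .exch 124 370 2, .cut 370,
    .exch 110 370 2, .exch 992 110 8, .exch 992 118 8, .exch 122 372 1, .cut 659, .cut 647,
    .exch 899 214 8, .exch 662 707 2, .exch 31 566 0, .exch 31 570 0, .exch 31 572 0, .cut 358,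
    .cut 665, .exch 539 905 1, .exch 539 913 1, .cut 372, .cut 364, .exch 124 358 3, .cut 362,
    .exch 118 362 2, .cut 661, .cut 653, .exch 535 901 1, .exch 541 647 3, .cut 370,
    .exch 110 370 2, .exch 992 110 8, .exch 992 122 8, .cut 659, .cut 647, .exch 535 899 2,
    .exch 118 558 4, .exch 118 570 2, .exch 118 572 1, .exch 905 118 9, .cut 409, .cut 397,
    .cut 395, .exch 425 31 5, .exch 110 570 2, .exch 110 572 1, .exch 913 110 9, .cut 405,
    .cut 403, .exch 433 31 5, .exch 409 899 3, .cut 628, .cut 614, .exch 118 620 1,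
    .exch 122 572 1, .exch 901 122 9, .cut 391, .exch 421 899 2, .cut 395, .exch 395 421 1,
    .cut 628, .cut 626, .exch 118 632 1, .cut 143, .exch 143 419 2, .cut 271, .exch 271 419 2,
    .exch 419 31 5, .exch 31 421 4, .cut 620, .cut 618, .exch 110 632 1, .exch 899 124 9,
    .exch 316 604 5, .cut 230, .cut 793, .exch 796 905 2, .exch 796 913 2, .cut 242, .cut 234,
    .exch 122 230 3, .cut 234, .exch 118 234 2, .cut 789, .cut 781, .cut 285, .exch 285 901 3,
    .cut 295, .exch 295 796 0, .exch 310 901 4, .cut 341, .exch 341 796 0, .exch 405 604 7,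
    .cut 242, .exch 110 242 2, .exch 992 110 7, .exch 992 122 7, .exch 118 248 1, .cut 787,
    .cut 779, .cut 775, .exch 899 604 7, .exch 835 796 6, .exch 31 310 0, .exch 31 314 0,
    .exch 31 316 0, .cut 614, .cut 409, .exch 283 905 1, .exch 283 913 1, .cut 628, .cut 620,
    .exch 124 614 3, .cut 618, .exch 118 618 2, .cut 405, .cut 397, .exch 279 901 1,
    .exch 285 391 3, .cut 626, .exch 110 626 2, .exch 992 110 9, .exch 992 122 9, .cut 403,
    .cut 391, .exch 279 899 2, .exch 124 302 4, .exch 124 310 3, .exch 124 314 2, .exch 899 124 8,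
    .cut 659, .cut 651, .cut 647, .exch 675 31 5, .exch 118 302 4, .exch 118 314 2,
    .exch 905 118 8, .cut 665, .cut 653, .exch 681 31 5, .exch 651 901 1, .cut 376, .cut 372,
    .exch 124 370 2, .exch 122 302 4, .exch 901 122 8, .cut 661, .exch 677 913 2, .cut 653,
    .exch 653 689 2, .cut 370, .cut 358, .exch 118 362 2, .cut 157, .exch 157 677 3, .cut 541,
    .exch 541 677 3, .exch 677 31 5, .exch 31 689 1, .cut 376, .cut 364, .exch 124 362 2,
    .exch 913 110 8, .cut 675, .cut 677, .cut 681, .cut 316, .exch 110 316 1, .cut 659, .cut 647,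
    .exch 647 689 1, .cut 376, .cut 362, .exch 122 364 1, .cut 151, .exch 151 675 2, .cut 535,
    .exch 535 675 2, .exch 675 31 5, .exch 31 689 3, .cut 372, .cut 358, .exch 118 364 1,
    .cut 364, .exch 62 364 1, .cut 358, .exch 124 358 3, .cut 665, .cut 651, .exch 681 31 5,
    .exch 653 675 2, .cut 376, .cut 370, .exch 122 372 1, .cut 372, .exch 110 372 1,
    .exch 992 110 8, .exch 992 118 8, .exch 124 370 2, .cut 661, .cut 653, .cut 647, .cut 539,
    .exch 677 539 5, .exch 31 689 2, .cut 535, .exch 535 677 1, .cut 541, .exch 541 677 3,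
    .exch 565 31 5, .exch 675 905 1, .exch 689 651 4, .exch 905 118 8, .exch 110 310 3,
    .exch 675 901 1, .exch 689 647 4, .exch 901 122 8, .exch 110 314 2, .exch 689 899 4,
    .exch 899 124 8, .exch 110 316 1, .exch 31 110 0, .exch 31 118 0, .exch 31 122 0,
    .exch 31 124 0, .cut 346, .exch 31 346 0, .exch 79 346 0, .exch 87 346 0, .exch 93 346 0,
    .cut 602, .exch 31 602 0, .exch 79 602 0, .exch 87 602 0, .exch 93 602 0, .cut 206,
    .exch 31 206 0, .exch 87 206 0, .exch 91 206 0, .exch 93 206 0, .cut 929, .cut 675, .cut 681,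
    .cut 677, .cut 689, .cut 737, .bad 454 [(0, 8), (4, 6), (3, 7)],
    .bad 458 [(0, 8), (4, 6), (2, 7)], .bad 460 [(0, 8), (4, 6), (1, 7)],
    .bad 466 [(0, 8), (3, 6), (2, 7)], .bad 468 [(0, 8), (3, 6), (1, 7)],
    .bad 472 [(0, 8), (2, 6), (1, 7)], .bad 838 [(0, 8), (4, 6), (3, 9)],
    .bad 842 [(0, 8), (4, 6), (2, 9)], .bad 844 [(0, 8), (4, 6), (1, 9)],
    .bad 850 [(0, 8), (3, 6), (2, 9)], .bad 852 [(0, 8), (3, 6), (1, 9)],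
    .bad 856 [(0, 8), (2, 6), (1, 9)], .cut 419, .cut 421, .cut 425, .cut 433, .cut 805, .cut 803,
    .cut 809, .cut 817, .cut 865, .bad 710 [(0, 7), (4, 6), (3, 9)],
    .bad 714 [(0, 7), (4, 6), (2, 9)], .cut 932, .cut 930, .cut 234, .cut 789, .cut 362, .cut 661,
    .exch 31 901 4, .exch 405 677 4, .cut 842, .cut 618, .exch 362 590 5, .exch 234 334 5,
    .cut 565, .exch 31 805 4, .exch 309 677 4, .cut 842, .cut 714, .exch 458 590 7, .cut 362,
    .exch 158 362 7, .cut 661, .cut 565, .exch 31 677 4, .exch 181 901 4, .cut 842, .cut 618,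
    .exch 362 590 5, .cut 458, .exch 62 458 5, .exch 110 930 2, .exch 286 618 8, .exch 158 842 7,
    .cut 405, .cut 309, .cut 181, .exch 31 421 4, .exch 419 932 0, .exch 419 992 0,
    .exch 422 675 2, .exch 482 675 6, .cut 230, .cut 793, .cut 569, .exch 569 905 4, .cut 454,
    .cut 358, .exch 230 334 5, .exch 91 817 3, .cut 665, .exch 313 665 5, .exch 31 905 4,
    .cut 710, .cut 614, .cut 583, .exch 583 738 0, .cut 611, .exch 590 611 2, .cut 551,
    .exch 595 551 4, .exch 675 590 7, .exch 110 482 2, .exch 110 678 3, .exch 118 234 2,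
    .exch 158 358 7, .exch 158 614 7, .cut 789, .cut 781, .cut 569, .cut 313, .cut 61,
    .exch 61 913 2, .exch 805 31 5, .exch 421 992 0, .exch 484 677 6, .exch 484 805 6, .cut 230,
    .cut 793, .cut 409, .exch 409 809 4, .cut 710, .cut 614, .exch 230 590 5, .exch 31 905 4,
    .cut 285, .exch 285 665 2, .exch 425 665 5, .cut 838, .cut 358, .exch 31 868 1,
    .exch 79 806 6, .exch 286 614 8, .exch 110 484 1, .exch 110 740 1, .exch 118 236 1,
    .exch 158 358 7, .exch 158 614 7, .cut 787, .cut 779, .cut 569, .cut 313, .cut 59,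
    .exch 59 913 1, .exch 803 31 5, .exch 803 961 1, .exch 803 992 0, .exch 809 866 0,
    .exch 817 835 4, .cut 167, .cut 856, .exch 346 872 1, .exch 376 602 5, .cut 647, .cut 391,
    .exch 31 899 2, .cut 143, .exch 143 775 3, .cut 151, .exch 151 775 4, .exch 167 542 5,
    .cut 171, .exch 171 421 1, .cut 852, .cut 850, .exch 342 849 1, .cut 47, .exch 47 419 2,
    .cut 143, .exch 143 419 2, .cut 173, .exch 173 419 2, .exch 419 31 8, .exch 425 31 8,
    .exch 31 421 4, .cut 844, .cut 842, .cut 838, .exch 849 590 8, .exch 433 805 4,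
    .exch 433 809 4, .exch 689 309 7, .exch 689 313 7, .exch 803 913 1, .exch 805 787 2,
    .exch 809 787 3, .cut 458, .cut 454, .cut 234, .cut 230, .exch 206 419 2, .exch 206 422 3,
    .exch 425 803 3, .exch 425 805 3, .exch 681 301 7, .exch 681 342 7, .exch 803 617 1,
    .exch 803 905 1, .exch 805 779 2, .bad 722 [(0, 7), (2, 6), (3, 9)],
    .bad 724 [(0, 7), (1, 6), (3, 9)], .cut 724, .cut 722, .cut 468, .cut 466, .cut 244, .cut 242,
    .exch 214 419 2, .cut 930, .exch 214 930 2, .cut 932, .exch 214 932 1, .exch 422 929 1,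
    .exch 419 805 1, .exch 675 348 7, .exch 805 611 2, .exch 805 899 2, .exch 899 124 7,
    .bad 728 [(0, 7), (2, 6), (1, 9)], .cut 728, .cut 472, .cut 248, .exch 220 425 2, .cut 936,
    .exch 220 936 2, .exch 428 992 2, .exch 488 188 6, .exch 932 440 2, .exch 220 944 2,
    .exch 677 346 7, .exch 929 613 7, .bad 426 [(0, 7), (2, 8), (4, 5)],
    .bad 434 [(0, 7), (2, 8), (3, 5)], .bad 440 [(0, 7), (2, 8), (1, 5)],
    .bad 906 [(0, 7), (2, 8), (4, 9)], .bad 914 [(0, 7), (2, 8), (3, 9)],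
    .bad 920 [(0, 7), (2, 8), (1, 9)], .exch 410 613 4, .exch 410 613 3, .exch 410 613 1,
    .bad 902 [(0, 7), (4, 8), (3, 9)], .cut 391, .cut 632, .exch 122 617 1, .exch 122 625 1,
    .cut 902, .cut 405, .cut 397, .exch 899 412 0, .exch 398 419 2, .exch 398 421 1, .cut 628,
    .cut 626, .exch 118 625 1, .exch 419 913 1, .exch 421 403 2, .exch 425 403 3, .exch 913 110 9,
    .cut 620, .cut 618, .cut 614, .cut 740, .exch 558 740 1, .exch 558 737 2, .exch 613 682 0,
    .exch 419 681 1, .exch 419 905 1, .exch 421 171 2, .exch 421 395 2, .exch 905 118 9, .cut 852,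
    .cut 850, .cut 628, .cut 626, .cut 752, .exch 566 752 1, .cut 944, .exch 944 598 8, .cut 690,
    .exch 992 690 6, .exch 566 689 1, .exch 692 992 2, .exch 419 677 1, .exch 419 901 1,
    .exch 677 346 9, .exch 901 122 9, .exch 929 229 8, .bad 728 [(0, 9), (1, 6), (2, 7)],
    .bad 810 [(0, 8), (2, 9), (4, 5)], .bad 906 [(0, 8), (2, 9), (4, 7)],
    .bad 920 [(0, 8), (2, 9), (1, 7)], .cut 856, .cut 632, .exch 602 992 1, .exch 604 419 2,
    .exch 728 346 7, .exch 728 794 6, .cut 824, .exch 728 824 6, .cut 872, .exch 728 872 4,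
    .cut 880, .exch 728 880 3, .exch 920 601 7, .exch 992 601 7, .exch 794 229 4, .exch 570 793 1,
    .exch 793 122 0, .exch 422 677 1, .bad 625 [(2, 6), (1, 9), (3, 5)],
    .bad 902 [(0, 8), (4, 9), (3, 7)], .cut 902, .cut 551, .cut 454, .cut 295, .cut 103, .cut 47,
    .exch 47 865 3, .cut 617, .exch 167 617 7, .exch 422 601 5, .exch 675 348 9,
    .bad 812 [(0, 8), (1, 9), (4, 5)], .bad 824 [(0, 8), (1, 9), (2, 5)],
    .bad 908 [(0, 8), (1, 9), (4, 7)], .bad 920 [(0, 8), (1, 9), (2, 7)], .exch 796 227 4,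
    .exch 796 227 2, .cut 230, .cut 793, .exch 794 905 1, .exch 796 779 2, .cut 244, .cut 242,
    .exch 118 241 1, .exch 110 229 1, .exch 118 229 1, .cut 920, .cut 787, .cut 779,
    .exch 899 796 7, .exch 675 992 0, .exch 677 738 0, .exch 681 738 0, .cut 230, .cut 793,
    .cut 787, .exch 787 905 1, .cut 244, .cut 236, .exch 124 230 3, .cut 539, .exch 539 913 1,
    .cut 779, .exch 689 779 4, .exch 899 31 7, .exch 913 31 7, .cut 248, .cut 234,
    .exch 122 744 1, .exch 110 738 2, .exch 110 740 1, .exch 118 234 2, .cut 789, .cut 787,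
    .cut 781, .cut 535, .exch 535 913 1, .cut 775, .exch 689 775 4, .exch 901 31 7,
    .exch 675 913 1, .exch 677 659 2, .exch 681 659 3, .exch 913 110 8, .cut 364, .cut 362,
    .cut 358, .exch 302 214 3, .cut 482, .exch 302 482 2, .cut 484, .exch 302 484 1, .cut 422,
    .exch 422 992 1, .cut 488, .exch 488 310 7, .exch 302 992 2, .cut 866, .exch 426 866 3,
    .exch 426 868 1, .exch 675 901 1, .exch 681 647 3, .exch 901 122 8, .exch 929 709 5,
    .bad 466 [(0, 8), (3, 6), (2, 7)], .bad 472 [(0, 8), (1, 6), (2, 7)],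
    .bad 850 [(0, 8), (3, 6), (2, 9)], .bad 856 [(0, 8), (1, 6), (2, 9)], .cut 376, .cut 370,
    .cut 496, .exch 314 496 1, .exch 342 681 2, .exch 348 675 2, .cut 880, .exch 314 880 1,
    .exch 342 992 4, .exch 348 992 4, .cut 372, .exch 372 976 2, .exch 62 345 5, .exch 121 364 0,
    .exch 339 364 4, .exch 684 901 3, .bad 355 [(2, 6), (3, 8), (4, 5)],
    .bad 361 [(2, 6), (1, 8), (4, 5)], .bad 451 [(2, 6), (3, 8), (4, 7)],
    .bad 835 [(2, 6), (3, 8), (4, 9)], .cut 668, .cut 665, .cut 662, .exch 158 653 1, .cut 692,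
    .exch 158 692 1, .exch 339 684 4, .cut 541, .exch 541 696 0, .exch 542 157 1, .exch 675 905 1,
    .exch 905 118 8, .exch 929 713 5, .bad 434 [(0, 5), (3, 8), (2, 7)],
    .bad 468 [(0, 8), (1, 6), (3, 7)], .bad 818 [(0, 5), (3, 8), (2, 9)],
    .bad 852 [(0, 8), (1, 6), (3, 9)], .cut 372, .exch 310 220 1, .exch 348 675 3,
    .exch 682 905 1, .bad 453 [(3, 6), (1, 8), (4, 7)], .bad 465 [(3, 6), (1, 8), (2, 7)],
    .bad 837 [(3, 6), (1, 8), (4, 9)], .bad 849 [(3, 6), (1, 8), (2, 9)], .exch 682 341 7,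
    .exch 682 341 9, .bad 229 [(3, 6), (1, 7), (4, 5)], .bad 613 [(3, 6), (1, 9), (4, 5)],
    .bad 709 [(3, 6), (1, 9), (4, 7)], .bad 721 [(3, 6), (1, 9), (2, 7)], .exch 213 810 4,
    .exch 597 426 4, .exch 901 122 8, .exch 913 110 8, .exch 651 677 1, .exch 653 689 2,
    .bad 707 [(3, 6), (4, 9), (2, 7)], .cut 707, .cut 370, .cut 358, .exch 199 675 2, .cut 481,
    .exch 481 118 8, .exch 992 227 8, .exch 342 482 2, .exch 899 124 8, .exch 929 707 5,
    .bad 428 [(0, 5), (1, 8), (4, 7)], .bad 436 [(0, 5), (1, 8), (3, 7)],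
    .bad 440 [(0, 5), (1, 8), (2, 7)], .bad 812 [(0, 5), (1, 8), (4, 9)],
    .bad 820 [(0, 5), (1, 8), (3, 9)], .cut 302, .cut 314, .cut 722, .cut 453, .cut 837, .cut 440,
    .cut 583, .exch 79 707 2, .exch 79 837 1, .exch 87 587 2, .exch 87 589 1, .exch 199 589 1,
    .bad 426 [(0, 5), (2, 8), (4, 7)], .cut 428, .cut 426, .exch 302 440 1, .cut 436, .cut 587,
    .exch 79 707 2, .exch 91 583 3, .cut 820, .cut 428, .cut 425, .exch 316 425 2, .cut 426,
    .exch 316 426 2, .cut 488, .exch 316 488 2, .exch 905 302 7, .exch 905 118 9, .exch 929 457 5,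
    .exch 457 302 7, .exch 436 566 7, .bad 692 [(0, 5), (3, 9), (1, 7)], .cut 331, .exch 91 361 1,
    .cut 841, .exch 91 841 1, .exch 334 345 1, .exch 345 809 4, .exch 481 346 0, .exch 793 333 4,
    .cut 242, .cut 230, .exch 214 482 2, .cut 433, .exch 316 433 2, .cut 496, .exch 316 496 2,
    .exch 929 316 7, .exch 913 110 9, .exch 929 465 5, .bad 684 [(0, 5), (4, 9), (1, 7)],
    .cut 595, .exch 31 722 0, .cut 812, .exch 428 558 7, .cut 339, .exch 87 817 2, .exch 91 789 3,
    .exch 481 342 0, .cut 234, .cut 230, .exch 206 482 2, .exch 901 122 7, .exch 961 805 6,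
    .exch 453 805 6, .bad 714 [(0, 7), (2, 6), (4, 9)], .bad 722 [(0, 7), (2, 6), (3, 9)],
    .bad 728 [(0, 7), (2, 6), (1, 9)], .cut 301, .exch 316 707 3, .exch 316 357 3,
    .exch 302 309 1, .cut 728, .cut 714, .exch 602 713 1, .exch 901 122 9, .exch 961 421 6,
    .bad 714 [(0, 9), (2, 6), (4, 7)], .bad 722 [(0, 9), (2, 6), (3, 7)],
    .bad 728 [(0, 9), (2, 6), (1, 7)], .cut 301, .exch 316 707 3, .exch 316 421 3,
    .exch 302 309 1, .cut 728, .cut 714, .exch 602 713 1, .exch 214 707 2, .exch 542 211 9,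
    .cut 812, .cut 428, .exch 302 737 1, .cut 908, .exch 302 908 1, .exch 211 738 0,
    .exch 590 242 9, .cut 781, .cut 397, .exch 31 901 3, .exch 286 653 8, .exch 122 316 1,
    .exch 901 122 8, .exch 677 707 2, .exch 110 316 1, .exch 913 110 8, .exch 689 707 4,
    .exch 899 992 0, .exch 905 930 0, .exch 913 930 0, .cut 737, .exch 737 899 5, .exch 737 901 5,
    .exch 737 905 5, .exch 737 913 5, .bad 454 [(0, 8), (4, 6), (3, 7)],
    .bad 458 [(0, 8), (4, 6), (2, 7)], .bad 460 [(0, 8), (4, 6), (1, 7)],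
    .bad 838 [(0, 8), (4, 6), (3, 9)], .bad 842 [(0, 8), (4, 6), (2, 9)],
    .bad 844 [(0, 8), (4, 6), (1, 9)], .bad 850 [(0, 8), (3, 6), (2, 9)],
    .bad 852 [(0, 8), (3, 6), (1, 9)], .bad 856 [(0, 8), (2, 6), (1, 9)], .cut 419,
    .exch 419 677 1, .exch 419 681 1, .exch 419 689 1, .exch 419 737 1,
    .bad 710 [(0, 9), (4, 6), (3, 7)], .bad 714 [(0, 9), (4, 6), (2, 7)],
    .bad 716 [(0, 9), (4, 6), (1, 7)], .bad 722 [(0, 9), (3, 6), (2, 7)],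
    .bad 724 [(0, 9), (3, 6), (1, 7)], .cut 803, .exch 421 803 2, .cut 405, .cut 618, .cut 714,
    .exch 62 714 5, .cut 789, .cut 309, .exch 31 805 4, .cut 279, .exch 279 565 1, .cut 285,
    .exch 285 565 3, .exch 405 542 7, .cut 234, .exch 234 590 5, .exch 590 930 2, .exch 842 206 8,
    .exch 62 458 5, .cut 661, .cut 565, .cut 181, .exch 31 677 4, .cut 181, .exch 181 899 5,
    .cut 842, .cut 362, .exch 334 930 2, .exch 458 590 7, .exch 62 458 5, .cut 789, .cut 565,
    .cut 309, .exch 31 805 4, .exch 31 421 4, .cut 661, .exch 309 661 5, .exch 309 675 8,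
    .exch 31 901 4, .cut 714, .cut 458, .cut 234, .cut 203, .exch 203 930 0, .exch 206 675 2,
    .cut 809, .exch 419 809 1, .cut 817, .exch 419 817 1, .cut 865, .exch 419 865 1,
    .exch 425 598 7, .exch 899 361 9, .exch 930 361 9, .exch 433 590 7, .exch 689 334 7,
    .exch 913 110 7, .exch 930 369 9, .bad 422 [(0, 8), (4, 7), (3, 5)],
    .bad 678 [(0, 9), (4, 7), (3, 5)], .cut 167, .cut 856, .exch 346 841 1, .exch 346 872 1,
    .cut 678, .cut 647, .exch 167 654 0, .exch 174 419 2, .exch 174 675 2, .cut 852, .cut 601,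
    .cut 345, .exch 93 880 2, .cut 421, .exch 421 675 2, .cut 425, .exch 425 675 3, .cut 433,
    .exch 433 675 4, .cut 481, .exch 481 31 6, .exch 677 346 9, .exch 681 342 9, .exch 899 233 8,
    .exch 689 334 9, .bad 818 [(0, 8), (3, 9), (2, 5)], .bad 906 [(0, 8), (4, 9), (2, 7)],
    .bad 914 [(0, 8), (3, 9), (2, 7)], .bad 920 [(0, 8), (2, 9), (1, 7)], .cut 109, .cut 914,
    .exch 790 899 2, .exch 790 930 2, .cut 236, .cut 205, .exch 109 206 0, .exch 79 229 1,
    .exch 93 103 3, .cut 920, .cut 906, .cut 410, .exch 410 905 1, .exch 457 794 7, .cut 675,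
    .exch 675 961 1, .cut 677, .exch 677 961 2, .cut 681, .exch 681 961 3, .cut 689,
    .exch 689 79 4, .exch 899 124 8, .exch 901 122 8, .exch 905 118 8, .exch 913 110 8,
    .bad 440 [(0, 5), (2, 8), (1, 7)], .bad 810 [(0, 5), (4, 8), (2, 9)],
    .bad 818 [(0, 5), (3, 8), (2, 9)], .bad 820 [(0, 5), (3, 8), (1, 9)],
    .bad 824 [(0, 5), (2, 8), (1, 9)], .cut 199, .cut 824, .exch 314 936 1, .exch 314 944 1,
    .cut 583, .cut 213, .cut 205, .exch 707 93 7, .exch 79 707 2, .exch 79 709 1, .cut 820,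
    .cut 818, .exch 310 944 1, .cut 218, .exch 79 218 0, .cut 220, .exch 79 220 0,
    .exch 901 122 7, .exch 93 186 0, .exch 899 124 7, .bad 440 [(0, 5), (2, 7), (1, 8)],
    .bad 696 [(0, 5), (2, 7), (1, 9)], .cut 614, .cut 409, .exch 155 905 1, .exch 155 913 1,
    .cut 628, .cut 620, .exch 124 614 3, .cut 358, .cut 665, .exch 155 905 1, .exch 155 913 1,
    .cut 372, .cut 364, .exch 124 358 3, .cut 838, .exch 62 838 5, .cut 806, .exch 79 806 6,
    .cut 866, .exch 79 866 2, .exch 110 835 3, .exch 110 992 3, .exch 286 103 8, .exch 327 872 0,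
    .exch 327 590 0, .cut 793, .cut 696, .cut 440, .exch 186 865 1, .exch 186 905 1, .cut 794,
    .exch 185 794 0, .exch 286 803 2, .cut 542, .exch 91 542 0, .cut 590, .exch 91 590 0,
    .cut 598, .exch 91 598 0, .cut 604, .exch 91 604 0, .exch 901 122 9, .exch 31 570 0,
    .exch 913 110 9, .exch 905 118 9, .exch 93 566 0, .exch 899 124 9, .exch 539 572 0,
    .bad 684 [(0, 5), (4, 9), (1, 7)], .bad 692 [(0, 5), (3, 9), (1, 7)],
    .bad 696 [(0, 5), (2, 9), (1, 7)], .cut 358, .cut 665, .exch 539 905 1, .exch 539 913 1,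
    .cut 372, .cut 364, .exch 124 358 3, .cut 362, .exch 118 362 2, .cut 661, .cut 653, .cut 157,
    .exch 157 901 3, .exch 453 541 7, .cut 355, .exch 110 355 2, .cut 370, .exch 110 370 2,
    .exch 451 110 8, .exch 992 110 8, .exch 992 122 8, .exch 451 572 7, .exch 835 227 8,
    .exch 118 376 1, .cut 659, .cut 651, .cut 647, .exch 899 188 8, .cut 707, .exch 535 707 2,
    .cut 595, .exch 595 675 4, .exch 611 91 5, .exch 587 675 3, .cut 334, .exch 91 334 0,
    .cut 342, .exch 91 342 0, .cut 348, .exch 91 348 0, .exch 913 110 8, .exch 905 118 8,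
    .exch 899 124 8, .bad 422 [(0, 5), (4, 8), (3, 7)], .bad 428 [(0, 5), (4, 8), (1, 7)],
    .bad 436 [(0, 5), (3, 8), (1, 7)], .bad 806 [(0, 5), (4, 8), (3, 9)],
    .bad 810 [(0, 5), (4, 8), (2, 9)], .bad 812 [(0, 5), (4, 8), (1, 9)],
    .bad 818 [(0, 5), (3, 8), (2, 9)], .bad 820 [(0, 5), (3, 8), (1, 9)], .cut 422, .cut 601,
    .exch 91 713 1, .exch 91 721 1, .cut 436, .cut 428, .exch 316 422 3, .cut 217, .cut 806,
    .exch 302 899 3, .exch 302 992 3, .exch 310 936 4, .cut 665, .exch 217 905 4, .cut 614,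
    .cut 558, .exch 358 558 6, .exch 913 110 9, .exch 590 295 9, .exch 62 590 4, .exch 358 542 5,
    .exch 721 302 9, .bad 838 [(4, 6), (0, 9), (3, 8)], .cut 248, .cut 185, .cut 569,
    .exch 409 569 7, .exch 316 241 3, .cut 440, .exch 121 440 0, .exch 121 936 6, .exch 124 409 5,
    .exch 744 313 7, .exch 220 295 7, .exch 91 713 1, .exch 91 721 1, .exch 93 203 2, .cut 820,
    .cut 818, .cut 812, .cut 806, .exch 316 806 3, .exch 992 310 9, .exch 118 905 4,
    .exch 122 103 3, .exch 124 103 3, .cut 230, .exch 107 230 0, .exch 109 230 0, .cut 793,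
    .cut 789, .cut 787, .cut 779, .exch 779 913 1, .cut 781, .exch 781 913 2, .exch 905 31 7,
    .cut 234, .exch 103 234 0, .cut 236, .exch 103 236 0, .cut 358, .exch 107 358 0,
    .exch 109 358 0, .cut 665, .cut 661, .cut 659, .cut 651, .exch 651 913 1, .cut 653,
    .exch 653 913 2, .exch 905 31 8, .cut 362, .exch 103 362 0, .cut 364, .exch 103 364 0,
    .exch 103 992 0, .exch 107 992 0, .exch 109 992 0, .cut 409, .cut 405, .cut 403, .cut 395,
    .exch 395 913 1, .cut 397, .exch 397 913 2, .exch 905 31 9, .exch 118 905 4, .exch 122 901 4,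
    .exch 124 899 4, .exch 914 961 1, .cut 405, .exch 405 899 2, .exch 405 905 2, .exch 405 961 2,
    .cut 620, .cut 618, .cut 614, .cut 110, .exch 992 110 9, .cut 558, .exch 992 558 6,
    .exch 62 103 3, .bad 227 [(4, 5), (3, 6), (2, 7)], .bad 233 [(4, 5), (2, 6), (1, 7)],
    .bad 355 [(4, 5), (3, 6), (2, 8)], .bad 357 [(4, 5), (3, 6), (1, 8)],
    .bad 361 [(4, 5), (2, 6), (1, 8)], .bad 611 [(4, 5), (3, 6), (2, 9)],
    .bad 613 [(4, 5), (3, 6), (1, 9)], .bad 617 [(4, 5), (2, 6), (1, 9)], .cut 406, .cut 617,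
    .exch 992 107 9, .exch 992 109 9, .cut 412, .cut 410, .exch 406 409 1, .cut 410,
    .exch 405 410 0, .cut 613, .cut 611, .exch 992 103 9, .cut 158, .exch 158 403 2, .cut 286,
    .exch 286 403 2, .exch 914 47 9, .cut 372, .cut 651, .exch 527 899 2, .exch 527 905 1,
    .cut 376, .cut 370, .exch 122 372 1, .exch 118 916 1, .exch 124 790 3, .cut 233, .cut 227,
    .cut 481, .exch 107 481 1, .exch 244 107 7, .exch 465 107 7, .exch 234 527 7, .exch 369 654 4,
    .cut 403, .exch 403 901 1, .cut 409, .exch 409 901 3, .cut 433, .exch 433 31 5, .cut 465,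
    .exch 465 31 6, .cut 626, .cut 397, .exch 901 31 9, .exch 905 31 9, .cut 632, .cut 628,
    .exch 124 626 2, .cut 628, .exch 122 628 1, .cut 395, .cut 391, .exch 899 31 9, .cut 632,
    .exch 118 632 1, .cut 752, .exch 118 752 1, .exch 961 124 9, .exch 976 118 9, .exch 122 604 1,
    .cut 647, .cut 376, .exch 122 496 1, .exch 124 370 2, .cut 775, .cut 653, .cut 651, .cut 535,
    .exch 905 535 8, .exch 31 901 3, .cut 527, .exch 527 905 1, .exch 647 781 1, .cut 651,
    .exch 651 901 1, .cut 372, .cut 370, .exch 118 496 1, .cut 143, .exch 143 899 2, .cut 527,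
    .exch 527 899 2, .cut 653, .exch 653 899 2, .exch 905 31 8, .exch 31 481 4, .cut 782,
    .exch 241 782 0, .exch 598 271 9, .exch 602 271 9, .exch 604 271 9, .cut 242, .cut 244,
    .cut 248, .exch 122 665 1, .exch 241 666 0]

theorem chainThreeStepsSecond_run :
    run 3 chainThreeStepsSecond [start [31, 62, 124, 122, 118]] = true := by
  decide +kernel

/-- Certificate for a full exchange, if `0`, `1`, `2` can successively be exchanged for `5`, `6`, `7`. -/
def fullExchangeSteps : List Step :=
  [.bad 271 [(4, 8), (3, 9), (2, 7), (1, 6), (0, 5)],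
    .bad 279 [(3, 8), (4, 9), (2, 7), (1, 6), (0, 5)],
    .bad 488 [(0, 5), (1, 6), (2, 7), (4, 8), (3, 9)],
    .bad 496 [(0, 5), (1, 6), (2, 7), (3, 8), (4, 9)], .cut 527, .cut 496, .exch 248 992 3,
    .cut 535, .cut 271, .exch 31 775 3, .cut 744, .cut 551, .exch 31 551 3, .cut 968,
    .exch 248 968 4, .bad 295 [(3, 5), (4, 8), (5, 9), (2, 7), (1, 6), (0, 5)],
    .bad 472 [(0, 5), (1, 6), (2, 7), (5, 8), (4, 9), (3, 5)], .cut 472, .cut 295, .cut 47,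
    .exch 47 279 3, .cut 976, .exch 248 976 3, .cut 440, .exch 440 752 3, .cut 327,
    .exch 31 327 3, .bad 327 [(4, 6), (3, 8), (6, 9), (2, 7), (1, 6), (0, 5)],
    .bad 440 [(0, 5), (1, 6), (2, 7), (6, 8), (3, 9), (4, 6)], .cut 696, .cut 583, .cut 87,
    .exch 87 775 4, .exch 327 248 8, .exch 327 752 8, .exch 775 199 8, .exch 527 248 9,
    .bad 992 [(0, 5), (1, 6), (2, 8), (3, 9), (4, 7)], .cut 79, .exch 79 279 3, .exch 279 992 4,
    .exch 391 124 7, .exch 775 248 9, .exch 31 236 4,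
    .bad 992 [(0, 5), (1, 6), (2, 9), (3, 8), (4, 7)], .cut 944, .exch 248 944 3, .exch 775 248 8,
    .exch 31 992 4, .bad 992 [(0, 5), (1, 6), (2, 8), (3, 9), (4, 7)], .exch 248 961 3, .cut 728,
    .exch 488 728 5, .cut 696, .exch 488 696 6, .cut 79, .exch 79 279 3,
    .bad 79 [(4, 6), (3, 8), (6, 9), (2, 7), (1, 6), (0, 5)],
    .bad 87 [(3, 6), (4, 8), (6, 9), (2, 7), (1, 6), (0, 5)], .cut 944, .cut 87, .cut 583,
    .exch 31 583 3, .exch 79 992 3, .exch 199 31 6, .exch 199 527 6, .cut 433, .exch 433 752 0,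
    .cut 434, .exch 434 752 1, .cut 436, .exch 436 752 2, .cut 440, .exch 440 551 3,
    .bad 376 [(0, 5), (1, 6), (2, 8), (4, 9), (3, 7)], .cut 376, .cut 372, .exch 372 488 2,
    .exch 775 124 8, .exch 992 348 5, .exch 31 488 4,
    .bad 992 [(0, 5), (1, 6), (2, 7), (5, 8), (3, 9), (4, 5)], .cut 327, .exch 31 327 3,
    .exch 527 248 9, .exch 279 457 4, .bad 143 [(4, 7), (3, 8), (2, 9), (1, 6), (0, 5)], .cut 880,
    .exch 31 992 4, .exch 632 976 3, .exch 488 856 5,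
    .bad 992 [(0, 5), (1, 6), (2, 7), (5, 8), (3, 9), (4, 5)], .cut 936, .exch 248 936 4,
    .exch 775 248 9, .exch 31 992 3, .bad 992 [(0, 5), (1, 6), (2, 9), (4, 8), (3, 7)], .cut 55,
    .exch 55 527 4, .cut 583, .exch 31 583 3, .cut 696, .exch 488 696 6,
    .bad 327 [(3, 6), (4, 8), (6, 9), (2, 7), (1, 6), (0, 5)],
    .bad 440 [(0, 5), (1, 6), (2, 7), (6, 8), (4, 9), (3, 6)], .cut 440, .cut 327, .cut 79,
    .exch 79 279 3, .cut 944, .exch 248 944 3, .exch 279 696 8, .exch 752 824 6, .exch 775 696 8,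
    .exch 824 248 8, .bad 143 [(4, 7), (3, 9), (2, 8), (1, 6), (0, 5)], .cut 143, .exch 31 992 4,
    .exch 47 151 3, .exch 527 248 9, .exch 167 880 7,
    .bad 992 [(0, 5), (1, 6), (2, 7), (5, 9), (3, 8), (4, 5)], .cut 936, .exch 248 936 4,
    .exch 527 752 3, .exch 31 992 3, .bad 376 [(0, 5), (1, 6), (2, 8), (4, 9), (3, 7)],
    .bad 391 [(3, 7), (4, 8), (2, 9), (1, 6), (0, 5)], .cut 391, .cut 376, .cut 372,
    .exch 372 488 2, .exch 775 124 8, .exch 992 316 6, .exch 248 316 6, .cut 143, .exch 143 775 3,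
    .cut 395, .exch 395 647 3, .exch 647 248 9, .exch 775 167 8, .exch 899 167 8, .exch 419 31 5,
    .bad 47 [(4, 5), (3, 8), (5, 9), (2, 7), (1, 6), (0, 5)],
    .bad 79 [(4, 6), (3, 9), (6, 8), (2, 7), (1, 6), (0, 5)], .cut 976, .cut 79, .exch 31 992 4,
    .cut 87, .exch 87 527 4, .exch 527 992 3, .exch 647 124 7, .exch 775 248 8, .exch 31 244 3,
    .bad 992 [(0, 5), (1, 6), (2, 8), (4, 9), (3, 7)], .exch 31 775 3, .cut 752, .cut 488,
    .exch 248 992 3, .cut 279, .cut 976, .exch 248 976 3, .cut 295, .exch 31 295 3,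
    .bad 47 [(4, 5), (3, 8), (5, 9), (2, 7), (1, 6), (0, 5)],
    .bad 55 [(3, 5), (4, 8), (5, 9), (2, 7), (1, 6), (0, 5)], .cut 968, .cut 47, .cut 551,
    .exch 31 551 3, .cut 472, .exch 472 992 3, .cut 440, .exch 440 744 4, .cut 583,
    .exch 31 583 3, .bad 79 [(4, 6), (3, 9), (6, 8), (2, 7), (1, 6), (0, 5)],
    .bad 87 [(3, 6), (4, 9), (6, 8), (2, 7), (1, 6), (0, 5)], .cut 944, .cut 87, .cut 327,
    .exch 31 327 3, .exch 31 992 4, .exch 79 496 3, .exch 143 583 3,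
    .bad 992 [(0, 5), (1, 6), (2, 8), (3, 9), (4, 7)], .cut 79, .exch 79 535 3, .exch 535 992 4,
    .exch 647 124 7, .exch 775 248 8, .exch 31 236 4,
    .bad 992 [(0, 5), (1, 6), (2, 8), (3, 9), (4, 7)], .cut 936, .exch 248 936 4, .exch 775 248 8,
    .exch 31 992 3, .bad 992 [(0, 5), (1, 6), (2, 8), (4, 9), (3, 7)], .cut 55, .exch 55 271 4,
    .exch 775 62 9, .cut 327, .exch 31 327 3, .cut 440, .exch 440 744 4,
    .bad 327 [(3, 6), (4, 8), (6, 9), (2, 7), (1, 6), (0, 5)],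
    .bad 440 [(0, 5), (1, 6), (2, 7), (6, 8), (4, 9), (3, 6)], .cut 696, .cut 583, .cut 79,
    .exch 79 775 3, .exch 775 248 9, .cut 944, .exch 248 944 3, .exch 440 632 7, .exch 535 248 9,
    .exch 566 744 4, .exch 496 824 6, .bad 143 [(4, 7), (3, 8), (2, 9), (1, 6), (0, 5)], .cut 143,
    .exch 31 678 4, .exch 47 151 3, .exch 271 248 8, .exch 167 880 7,
    .bad 992 [(0, 5), (1, 6), (2, 7), (5, 8), (3, 9), (4, 5)], .exch 31 496 3, .cut 936,
    .exch 248 936 4, .exch 31 992 3, .bad 376 [(0, 5), (1, 6), (2, 8), (4, 9), (3, 7)], .cut 647,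
    .exch 151 899 2, .cut 651, .exch 535 651 2, .cut 143, .exch 659 143 4, .exch 271 248 8,
    .exch 775 248 8, .bad 992 [(0, 5), (1, 6), (2, 7), (5, 8), (3, 9), (4, 5)], .cut 87,
    .exch 87 271 4, .exch 271 992 3, .exch 391 124 7, .exch 775 248 9, .exch 31 244 3,
    .bad 992 [(0, 5), (1, 6), (2, 9), (4, 8), (3, 7)], .exch 248 961 4, .cut 728, .exch 496 728 5,
    .cut 696, .exch 496 696 6, .cut 87, .exch 87 271 4,
    .bad 79 [(4, 6), (3, 8), (6, 9), (2, 7), (1, 6), (0, 5)],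
    .bad 87 [(3, 6), (4, 8), (6, 9), (2, 7), (1, 6), (0, 5)], .cut 936, .cut 79, .cut 583,
    .exch 31 583 3, .exch 31 744 4, .cut 440, .exch 440 992 3, .exch 535 992 4,
    .bad 376 [(0, 5), (1, 6), (2, 8), (3, 9), (4, 7)], .cut 376, .cut 364, .exch 364 496 2,
    .exch 775 124 8, .exch 992 348 5, .exch 31 496 3,
    .bad 992 [(0, 5), (1, 6), (2, 7), (5, 8), (4, 9), (3, 5)], .cut 327, .exch 31 327 3,
    .exch 535 248 9, .exch 535 496 9, .exch 271 465 3,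
    .bad 143 [(4, 7), (3, 8), (2, 9), (1, 6), (0, 5)],
    .bad 151 [(3, 7), (4, 8), (2, 9), (1, 6), (0, 5)], .cut 872, .cut 143, .exch 31 744 4,
    .exch 79 151 3, .exch 199 880 7, .cut 376, .exch 376 992 3, .exch 880 345 5, .exch 992 856 5,
    .exch 31 496 3, .exch 55 391 4, .bad 167 [(3, 5), (4, 7), (5, 8), (2, 9), (1, 6), (0, 5)],
    .bad 440 [(0, 5), (1, 6), (2, 7), (6, 8), (3, 9), (4, 6)], .cut 440, .cut 167, .cut 47,
    .exch 47 151 3, .exch 295 248 8, .cut 944, .exch 248 944 3, .exch 775 248 9, .exch 31 992 4,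
    .bad 992 [(0, 5), (1, 6), (2, 9), (3, 8), (4, 7)]]

theorem fullExchangeSteps_run :
    run 0 fullExchangeSteps [start [31, 62, 124, 248]] = true := by
  decide +kernel

/-- The labeling `e` admits `k` consecutive exchanges of distinct elements. -/
def HasChain (M : Matroid β) (e : Fin 10 → β) (k : ℕ) : Prop :=
  ∃ p Y, Walk (baseMasks M e) 31 p Y ∧ accept k p Y = true

theorem exists_labeling_good_one (hA : M.IsBase A) (hB : M.IsBase B) (hA5 : A.encard = 5)
    (hB5 : B.encard = 5) (hAB : Disjoint A B) :
    ∃ e, IsLabeling A B e ∧ Good (baseMasks M e) 62 := by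
  obtain ⟨a, ha⟩ : A.Nonempty := by
    rw [← encard_ne_zero, hA5]; norm_num
  obtain ⟨b, -, hb, h1, h2⟩ := hA.exists_exchangeable hB ⟨ha, hAB.notMem_of_mem_left ha⟩
  obtain ⟨e, he, hl, hr⟩ := exists_labeling (l := [a]) (m := [b]) hA5 hB5 hAB (by simp)
    (by simpa) (by simp) (by simpa using hb.1)
  refine ⟨e, he, ?_, ?_⟩
  · have := maskSet_move (X := 31) (i := 0) (j := 5) he.inj (by decide) (by decide)
    rw [he.left, hl 0 a rfl, hr 5 b le_rfl rfl] at this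
    change M.IsBase (maskSet e (move 31 (0 : Fin 10) (5 : Fin 10)))
    rwa [this]
  · have := maskSet_co_move (X := 31) (i := 0) (j := 5) he.inj (by decide) (by decide)
    rw [he.right, hl 0 a rfl, hr 5 b le_rfl rfl] at this
    change M.IsBase (maskSet e (co (move 31 (0 : Fin 10) (5 : Fin 10))))
    rwa [this]

theorem IsLabeling.mem_left {i : Fin 10} (he : IsLabeling A B e) (hi : (i : ℕ) < 5) : e i ∈ A := by
  rw [← he.left, mem_maskSet he.inj, testBit_31, decide_eq_true hi]

theorem IsLabeling.mem_right {i : Fin 10} (he : IsLabeling A B e) (hi : 5 ≤ (i : ℕ)) : e i ∈ B := by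
  rw [← he.right, mem_maskSet he.inj, testBit_co_31, decide_eq_true hi]

/-- Relabeling so that prescribed elements come first. -/
theorem IsLabeling.exists_relabeling (he : IsLabeling A B e) (hA5 : A.encard = 5)
    (hB5 : B.encard = 5) (hAB : Disjoint A B) {l m : List (Fin 10)} (hl : l.Nodup)
    (hlA : ∀ i ∈ l, (i : ℕ) < 5) (hm : m.Nodup) (hmB : ∀ i ∈ m, 5 ≤ (i : ℕ)) :
    ∃ e', IsLabeling A B e' ∧ (∀ i j : Fin 10, l[(i : ℕ)]? = some j → e' i = e j) ∧
      ∀ i j : Fin 10, 5 ≤ (i : ℕ) → m[(i : ℕ) - 5]? = some j → e' i = e j := by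
  obtain ⟨e', he', h1, h2⟩ := exists_labeling (l := l.map e) (m := m.map e) hA5 hB5 hAB
    (hl.map he.inj) (by simpa using fun i hi => he.mem_left (hlA i hi))
    (hm.map he.inj) (by simpa using fun i hi => he.mem_right (hmB i hi))
  exact ⟨e', he', fun i j hj => h1 i _ (by simp [hj]), fun i j hi hj => h2 i _ hi (by simp [hj])⟩

theorem testBit_move_of_ne {i j k : ℕ} (hi : i ≠ k) (hj : j ≠ k) :
    (move X i j).testBit k = X.testBit k := by
  simp [testBit_move, hi, hj]

theorem ne_of_testBit_move {i j k : ℕ} (hi : X.testBit i = true)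
    (hk : (move X i j).testBit k = true) (hj : j ≠ i) : i ≠ k := by
  rintro rfl
  simp [testBit_move, hi, hj] at hk

theorem ne_of_testBit_move' {i j k : ℕ} (hj : X.testBit j = false)
    (hk : (move X i j).testBit k = false) (hi : i ≠ j) : j ≠ k := by
  rintro rfl
  simp [testBit_move, hj, hi] at hk

theorem exists_labeling_good_two (hA : M.IsBase A) (hB : M.IsBase B) (hA5 : A.encard = 5)
    (hB5 : B.encard = 5) (hAB : Disjoint A B) :
    ∃ e, IsLabeling A B e ∧ Good (baseMasks M e) 62 ∧ Good (baseMasks M e) 124 := by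
  obtain ⟨e, he, h1⟩ := exists_labeling_good_one hA hB hA5 hB5 hAB
  have h0 : Good (baseMasks M e) 31 :=
    ⟨by rwa [baseMasks, he.left], by rwa [baseMasks, he.right]⟩
  obtain ⟨p, Y, hw, ha⟩ := exists_walk (M := M) (L := [31, 62]) he.inj (by simp [h0, h1])
    chainTwoSteps_run
  simp only [accept, Bool.and_eq_true, Nat.beq_eq] at ha
  obtain ⟨hlen, hall⟩ := ha
  obtain ⟨⟨i₀, j₀⟩, ⟨i₁, j₁⟩, rfl⟩ := List.length_eq_two.1 hlen
  simp only [List.all_cons, List.all_nil, Bool.and_true, Bool.and_eq_true, Nat.ble_eq] at hall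
  obtain ⟨⟨hi₀, hj₀⟩, hi₁, hj₁⟩ := hall
  obtain ⟨-, hj₀', hXi₀, hXj₀, hg₀, -, hj₁', hXi₁, hXj₁, hg₁, -⟩ := hw
  have hi := ne_of_testBit_move hXi₀ hXi₁ (by omega)
  have hj := ne_of_testBit_move' hXj₀ hXj₁ (by omega)
  lift i₀ to Fin 10 using by omega
  lift j₀ to Fin 10 using by omega
  lift i₁ to Fin 10 using by omega
  lift j₁ to Fin 10 using by omega
  obtain ⟨e', he', hl, hr⟩ := he.exists_relabeling hA5 hB5 hAB (l := [i₀, i₁]) (m := [j₀, j₁])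
    (by simpa [← Fin.val_inj]) (by simp; omega) (by simpa [← Fin.val_inj]) (by simp; omega)
  have hs₁ := (he.sameMask he').move (i' := 0) (j' := 5) he.inj he'.inj hXi₀ hXj₀ (hl 0 _ rfl)
    (hr 5 _ le_rfl rfl)
  have hs₂ := hs₁.move (i' := 1) (j' := 6) he.inj he'.inj hXi₁ hXj₁ (hl 1 _ rfl)
    (hr 6 _ (by decide) rfl)
  exact ⟨e', he', hs₁.good hg₀, hs₂.good hg₁⟩

theorem exists_chain_three_of_common_partner (hA : M.IsBase A) (hB : M.IsBase B)
    (hA5 : A.encard = 5) (hB5 : B.encard = 5) (hAB : Disjoint A B) (he : IsLabeling A B e)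
    (h1 : Good (baseMasks M e) 62) (h2 : Good (baseMasks M e) 124) {x y z : Fin 10}
    (hx : 2 ≤ (x : ℕ) ∧ (x : ℕ) < 5) (hy : 2 ≤ (y : ℕ) ∧ (y : ℕ) < 5) (hxy : x ≠ y)
    (hz : z = 0 ∨ z = 1) (hxz : Good (baseMasks M e) (move 124 x z))
    (hyz : Good (baseMasks M e) (move 124 y z)) :
    ∃ e, IsLabeling A B e ∧ HasChain M e 3 := by
  have h124 : ∀ w : Fin 10, 2 ≤ (w : ℕ) ∧ (w : ℕ) < 5 → Nat.testBit 124 w = true := by decide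
  obtain ⟨e', he', hl, hr⟩ := he.exists_relabeling hA5 hB5 hAB (l := [0, 1, x, y]) (m := [5, 6])
    (by simp; omega) (by simp; omega) (by simp) (by simp)
  have h0 : Good (baseMasks M e') 31 :=
    ⟨by rwa [baseMasks, he'.left], by rwa [baseMasks, he'.right]⟩
  have hs₁ : SameMask e e' 62 62 := (he.sameMask he').move (i := 0) (j := 5) (i' := 0) (j' := 5)
    he.inj he'.inj (by decide) (by decide) (hl 0 _ rfl) (hr 5 _ le_rfl rfl)
  have hs₂ : SameMask e e' 124 124 := hs₁.move (i := 1) (j := 6) (i' := 1) (j' := 6)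
    he.inj he'.inj (by decide) (by decide) (hl 1 _ rfl) (hr 6 _ (by decide) rfl)
  refine ⟨e', he', ?_⟩
  rcases hz with rfl | rfl
  · have hsx : SameMask e e' _ 121 := hs₂.move (i' := 2) (j' := 0) he.inj he'.inj (h124 x hx)
      (by decide) (hl 2 _ rfl) (hl 0 _ rfl)
    have hsy : SameMask e e' _ 117 := hs₂.move (i' := 3) (j' := 0) he.inj he'.inj (h124 y hy)
      (by decide) (hl 3 _ rfl) (hl 0 _ rfl)
    exact exists_walk (M := M) (L := [31, 62, 124, 121, 117]) he'.inj
      (by simpa using ⟨h0, hs₁.good h1, hs₂.good h2, hsx.good hxz, hsy.good hyz⟩)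
      chainThreeStepsFirst_run
  · have hsx : SameMask e e' _ 122 := hs₂.move (i' := 2) (j' := 1) he.inj he'.inj (h124 x hx)
      (by decide) (hl 2 _ rfl) (hl 1 _ rfl)
    have hsy : SameMask e e' _ 118 := hs₂.move (i' := 3) (j' := 1) he.inj he'.inj (h124 y hy)
      (by decide) (hl 3 _ rfl) (hl 1 _ rfl)
    exact exists_walk (M := M) (L := [31, 62, 124, 122, 118]) he'.inj
      (by simpa using ⟨h0, hs₁.good h1, hs₂.good h2, hsx.good hxz, hsy.good hyz⟩)
      chainThreeStepsSecond_run

theorem hasChain_or_good_move (he : e.Injective) (h1 : Good (baseMasks M e) 62)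
    (h2 : Good (baseMasks M e) 124) {x : Fin 10} (hx : 2 ≤ (x : ℕ) ∧ (x : ℕ) < 5) :
    HasChain M e 3 ∨ ∃ z : Fin 10, (z = 0 ∨ z = 1) ∧ Good (baseMasks M e) (move 124 x z) := by
  have hx1 : Nat.testBit 124 x = true := by revert x; decide
  have hx2 : Nat.testBit (co 124) x = false := by revert x; decide
  obtain ⟨j, hj, hjY, hjX, h3, h4⟩ := exchangeFamily_baseMasks M he h2.1 h2.2 (by omega) hx1 hx2
  have hg : Good (baseMasks M e) (move 124 x j) := ⟨h3, by rwa [co_move]⟩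
  by_cases hj2 : j < 2
  · exact .inr ⟨⟨j, by omega⟩, by simp only [Fin.ext_iff]; simp; omega, hg⟩
  · have hj5 : 5 ≤ j := by
      by_contra h
      interval_cases j <;> revert hjX <;> decide
    refine .inl ⟨[(0, 5), (1, 6), (x, j)], _, ⟨by decide, by decide, by decide, by decide, h1,
      by decide, by decide, by decide, by decide, h2, by omega, hj, hx1, hjX, hg, rfl⟩, ?_⟩
    simp [accept, hj5]; omega

theorem exists_labeling_hasChain (hA : M.IsBase A) (hB : M.IsBase B) (hA5 : A.encard = 5)
    (hB5 : B.encard = 5) (hAB : Disjoint A B) : ∃ e, IsLabeling A B e ∧ HasChain M e 3 := by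
  obtain ⟨e, he, h1, h2⟩ := exists_labeling_good_two hA hB hA5 hB5 hAB
  by_contra hc
  have key : ∀ x : Fin 10, 2 ≤ (x : ℕ) ∧ (x : ℕ) < 5 → ∃ z : Fin 10, (z = 0 ∨ z = 1) ∧
      Good (baseMasks M e) (move 124 x z) := fun x hx =>
    (hasChain_or_good_move he.inj h1 h2 hx).resolve_left fun h => hc ⟨e, he, h⟩
  have hne : ∀ x y z : Fin 10, 2 ≤ (x : ℕ) ∧ (x : ℕ) < 5 → 2 ≤ (y : ℕ) ∧ (y : ℕ) < 5 → x ≠ y →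
      (z = 0 ∨ z = 1) → Good (baseMasks M e) (move 124 x z) →
      ¬ Good (baseMasks M e) (move 124 y z) := fun x y z hx hy hxy hz h h' =>
    hc (exists_chain_three_of_common_partner hA hB hA5 hB5 hAB he h1 h2 hx hy hxy hz h h')
  obtain ⟨u, hu, hgu⟩ := key 2 (by decide)
  obtain ⟨v, hv, hgv⟩ := key 3 (by decide)
  obtain ⟨w, hw, hgw⟩ := key 4 (by decide)
  have huv : u ≠ v := by
    rintro rfl; exact hne _ _ _ (by decide) (by decide) (by decide) hu hgu hgv
  have huw : u ≠ w := by
    rintro rfl; exact hne _ _ _ (by decide) (by decide) (by decide) hu hgu hgw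
  have hvw : v ≠ w := by
    rintro rfl; exact hne _ _ _ (by decide) (by decide) (by decide) hv hgv hgw
  rcases hu with rfl | rfl <;> rcases hv with rfl | rfl <;> rcases hw with rfl | rfl <;>
    contradiction

theorem exists_labeling_good_three (hA : M.IsBase A) (hB : M.IsBase B) (hA5 : A.encard = 5)
    (hB5 : B.encard = 5) (hAB : Disjoint A B) :
    ∃ e, IsLabeling A B e ∧ Good (baseMasks M e) 62 ∧ Good (baseMasks M e) 124 ∧
      Good (baseMasks M e) 248 := by
  obtain ⟨e, he, p, Y, hw, ha⟩ := exists_labeling_hasChain hA hB hA5 hB5 hAB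
  simp only [accept, Bool.and_eq_true, Nat.beq_eq] at ha
  obtain ⟨hlen, hall⟩ := ha
  obtain ⟨⟨i₀, j₀⟩, ⟨i₁, j₁⟩, ⟨i₂, j₂⟩, rfl⟩ := List.length_eq_three.1 hlen
  simp only [List.all_cons, List.all_nil, Bool.and_true, Bool.and_eq_true, Nat.ble_eq] at hall
  obtain ⟨⟨hi₀, hj₀⟩, ⟨hi₁, hj₁⟩, hi₂, hj₂⟩ := hall
  obtain ⟨-, hj₀', hXi₀, hXj₀, hg₀, -, hj₁', hXi₁, hXj₁, hg₁, -, hj₂', hXi₂, hXj₂, hg₂, -⟩ := hw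
  have hi₀₁ := ne_of_testBit_move hXi₀ hXi₁ (by omega)
  have hj₀₁ := ne_of_testBit_move' hXj₀ hXj₁ (by omega)
  have hi₁₂ := ne_of_testBit_move hXi₁ hXi₂ (by omega)
  have hj₁₂ := ne_of_testBit_move' hXj₁ hXj₂ (by omega)
  have hi₀₂ : i₀ ≠ i₂ := by
    rintro rfl
    rw [testBit_move_of_ne hi₁₂ (by omega)] at hXi₂
    exact ne_of_testBit_move hXi₀ hXi₂ (by omega) rfl
  have hj₀₂ : j₀ ≠ j₂ := by
    rintro rfl
    rw [testBit_move_of_ne (by omega) hj₁₂] at hXj₂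
    exact ne_of_testBit_move' hXj₀ hXj₂ (by omega) rfl
  lift i₀ to Fin 10 using by omega
  lift j₀ to Fin 10 using by omega
  lift i₁ to Fin 10 using by omega
  lift j₁ to Fin 10 using by omega
  lift i₂ to Fin 10 using by omega
  lift j₂ to Fin 10 using by omega
  obtain ⟨e', he', hl, hr⟩ := he.exists_relabeling hA5 hB5 hAB (l := [i₀, i₁, i₂])
    (m := [j₀, j₁, j₂]) (by simp [← Fin.val_inj]; omega) (by simp; omega) (by simp [← Fin.val_inj]; omega)
    (by simp; omega)
  have hs₁ := (he.sameMask he').move (i' := 0) (j' := 5) he.inj he'.inj hXi₀ hXj₀ (hl 0 _ rfl)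
    (hr 5 _ le_rfl rfl)
  have hs₂ := hs₁.move (i' := 1) (j' := 6) he.inj he'.inj hXi₁ hXj₁ (hl 1 _ rfl)
    (hr 6 _ (by decide) rfl)
  have hs₃ := hs₂.move (i' := 2) (j' := 7) he.inj he'.inj hXi₂ hXj₂ (hl 2 _ rfl)
    (hr 7 _ (by decide) rfl)
  exact ⟨e', he', hs₁.good hg₀, hs₂.good hg₁, hs₃.good hg₂⟩

theorem exists_fullSerialSymmExchange_of_disjoint (hA : M.IsBase A) (hB : M.IsBase B)
    (hA5 : A.encard = 5) (hB5 : B.encard = 5) (hAB : Disjoint A B) :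
    ∃ n ≤ 6, M.FullSerialSymmExchange n A B := by
  obtain ⟨e, he, h1, h2, h3⟩ := exists_labeling_good_three hA hB hA5 hB5 hAB
  have h0 : Good (baseMasks M e) 31 :=
    ⟨by rwa [baseMasks, he.left], by rwa [baseMasks, he.right]⟩
  obtain ⟨p, Y, hw, ha⟩ := exists_walk (M := M) (L := [31, 62, 124, 248]) he.inj
    (by simp [h0, h1, h2, h3]) fullExchangeSteps_run
  simp only [accept, Bool.and_eq_true, Nat.ble_eq, Nat.beq_eq] at ha
  obtain ⟨hlen, rfl⟩ := ha
  refine ⟨p.length, hlen, ?_⟩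
  have hs := serialSymmExchange_of_walk (n := 0) (A := A) (B := B) (M := M) he.inj
    (by rw [he.left, he.right]; exact .refl hA hB) hw
  rwa [zero_add, show (992 : ℕ) = co 31 from rfl, co_co, he.left, he.right] at hs

end ExchangeSearch

namespace Matroid
variable {α β : Type*} {M : Matroid α} {A B : Set α}

theorem isBase_comap_iff_of_isBase {g : β → α} (hA : M.IsBase A) (hAg : A ⊆ range g)
    (hg : range g ⊆ M.E) {S : Set β} :
    (M.comap g).IsBase S ↔ M.IsBase (g '' S) ∧ InjOn g S := by
  have hpre : g ⁻¹' M.E = univ := by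
    rwa [preimage_eq_univ_iff]
  rw [comap_isBase_iff, hpre, image_univ]
  constructor
  · rintro ⟨h1, h2, -⟩
    exact ⟨hA.isBase_of_isBasis_superset hAg h1, h2⟩
  · rintro ⟨h1, h2⟩
    exact ⟨h1.isBasis_of_subset hg (image_subset_range _ _), h2, subset_univ _⟩

theorem SerialSymmExchange.isBase {n : ℕ} {S T S₁ T₁ : Set α}
    (h : M.SerialSymmExchange n S T S₁ T₁) : M.IsBase S₁ ∧ M.IsBase T₁ := by
  cases h with
  | refl hA hB => exact ⟨hA, hB⟩
  | step _ hab => exact ⟨hab.2.2.1, hab.2.2.2⟩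

theorem image_insert_sdiff_singleton {g : β → α} {S : Set β} {a b : β} (hS : InjOn g S)
    (ha : a ∈ S) : g '' insert b (S \ {a}) = insert (g b) (g '' S \ {g a}) := by
  rw [image_insert_eq, hS.image_sdiff_subset (singleton_subset_iff.2 ha), image_singleton]

/-- Serial exchanges in a parallel extension project to serial exchanges that are not longer. -/
theorem SerialSymmExchange.of_comap {g : β → α} (hA : M.IsBase A) (hAg : A ⊆ range g)
    (hg : range g ⊆ M.E) {n : ℕ} {S T S₁ T₁ : Set β}
    (h : (M.comap g).SerialSymmExchange n S T S₁ T₁) :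
    ∃ m ≤ n, M.SerialSymmExchange m (g '' S) (g '' T) (g '' S₁) (g '' T₁) := by
  have key {S : Set β} := isBase_comap_iff_of_isBase hA hAg hg (S := S)
  induction h with
  | refl hS hT => exact ⟨0, le_rfl, .refl (key.1 hS).1 (key.1 hT).1⟩
  | @step n S T S₁ T₁ a b h hab ih =>
    obtain ⟨m, hm, hs⟩ := ih
    obtain ⟨⟨haS, haT⟩, ⟨hbT, hbS⟩, h1, h2⟩ := hab
    rw [key] at h1 h2
    have hS := image_insert_sdiff_singleton (b := b) (key.1 h.isBase.1).2 haS
    have hT := image_insert_sdiff_singleton (b := a) (key.1 h.isBase.2).2 hbT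
    by_cases hgab : g a = g b
    · refine ⟨m, by omega, ?_⟩
      rw [← hgab, insert_sdiff_self_of_mem (mem_image_of_mem g haS)] at hS
      rw [hgab, insert_sdiff_self_of_mem (mem_image_of_mem g hbT)] at hT
      rwa [hS, hT]
    · refine ⟨m + 1, by omega, ?_⟩
      have h1' := h1.1
      have h2' := h2.1
      rw [hS] at h1' ⊢
      rw [hT] at h2' ⊢
      refine hs.step ⟨⟨mem_image_of_mem g haS, ?_⟩, ⟨mem_image_of_mem g hbT, ?_⟩, h1', h2'⟩
      · rintro ⟨t, ht, hta⟩
        have htb : t ≠ b := by rintro rfl; exact hgab hta.symm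
        exact haT (h2.2 (.inr ⟨ht, htb⟩) (.inl rfl) hta ▸ ht)
      · rintro ⟨t, ht, htb⟩
        have hta : t ≠ a := by rintro rfl; exact hgab htb
        exact hbS (h1.2 (.inr ⟨ht, hta⟩) (.inl rfl) htb ▸ ht)

end Matroid

theorem mainTheorem2 {α : Type*} (M : Matroid α) (hM : M.eRank = 5) (A B : Set α)
    (hA : M.IsBase A) (hB : M.IsBase B) :
    ∃ n : ℕ, n ≤ 6 ∧ M.FullSerialSymmExchange n A B := by
  let g : A ⊕ B → α := Sum.elim (↑) (↑)
  have hl : g '' range Sum.inl = A := by simp [g, ← range_comp]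
  have hr : g '' range Sum.inr = B := by simp [g, ← range_comp]
  have hAg : A ⊆ range g := fun x hx => ⟨.inl ⟨x, hx⟩, rfl⟩
  have hg : range g ⊆ M.E := by
    simp [g, Sum.elim_range, hA.subset_ground, hB.subset_ground]
  have hAb : (M.comap g).IsBase (range Sum.inl) := by
    rw [Matroid.isBase_comap_iff_of_isBase hA hAg hg, hl]
    refine ⟨hA, ?_⟩
    rintro _ ⟨x, rfl⟩ _ ⟨y, rfl⟩ h
    exact congrArg _ (Subtype.ext h)
  have hBb : (M.comap g).IsBase (range Sum.inr) := by
    rw [Matroid.isBase_comap_iff_of_isBase hA hAg hg, hr]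
    refine ⟨hB, ?_⟩
    rintro _ ⟨x, rfl⟩ _ ⟨y, rfl⟩ h
    exact congrArg _ (Subtype.ext h)
  have hA5 : (range (Sum.inl : A → A ⊕ B)).encard = 5 := by
    rw [← ((Matroid.isBase_comap_iff_of_isBase hA hAg hg).1 hAb).2.encard_image, hl,
      hA.encard_eq_eRank, hM]
  have hB5 : (range (Sum.inr : B → A ⊕ B)).encard = 5 := by
    rw [← ((Matroid.isBase_comap_iff_of_isBase hA hAg hg).1 hBb).2.encard_image, hr,
      hB.encard_eq_eRank, hM]
  obtain ⟨n, hn, h⟩ := ExchangeSearch.exists_fullSerialSymmExchange_of_disjoint hAb hBb hA5 hB5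
    isCompl_range_inl_range_inr.disjoint
  obtain ⟨m, hm, hs⟩ := h.of_comap hA hAg hg
  rw [hl, hr] at hs
  exact ⟨m, hm.trans hn, hs⟩
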